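/- **Conventions.** Circuits are Boolean circuits described by bit strings; the size $|C|$ of a circuit is the length of its description, and appending zeros to a description (padding) does not change the function it computes. All PPT algorithms are non-uniform, i.e. families of randomized circuits (with oracle gates where an oracle is present) of size polynomial in the security parameter $k$ and the input lengths. "Polynomial size" means polynomially bounded in $k$. A function $\varepsilon(k)$ is negligible if $\varepsilon(k)=O(k^{-c})$ for every $c>0$. Let $\mathcal C=\{f_s\}$ be a family of polynomial-size circuits $f_s\colon\{0,1\}^{\ell(k)}\to\{0,1\}^{\ell'(k)}$, $s\in\{0,1\}^k$, $k\in\mathbb N$, where $\ell,\ell'$ are polynomially bounded. **Pseudo-entropy.** $\mathcal C$ has pseudo-entropy at least $p(k)$ on sets $I_k\subseteq\{0,1\}^{\ell(k)}$ of polynomial size $t(k)$ if for all $k$ and $s\in\{0,1\}^k$ there are random variables $Y^{s}\in(\{0,1\}^{\ell'(k)})^{I_k}$ such that (1) for all sufficiently large $k$ and all $s\in\{0,1\}^k$, each value of $Y^{s}$ has probability at most $2^{-p(k)}$; (2) for every oracle PPT $D$, $\left|\Pr[D^{f_s}(1^k)=1]-\Pr[D^{f_s\circ Y^{s}}(1^k)=1]\right|$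 is negligible, where $s\in\{0,1\}^k$ is uniform and $f_s\circ Y^s$ agrees with $f_s$ off $I_k$ and with $Y^s$ on $I_k$. $\mathcal C$ has super-polynomial pseudo-entropy if for every polynomial $p$ it has pseudo-entropy at least $p(k)$ on some such sets. **Obfuscators.** A (possibly inefficient) randomized map $\mathcal O$ from circuits to circuits, which may also depend on $k$, is an average-case VBB obfuscator of $\mathcal C$ with independent auxiliary inputs if: $\mathcal O(f_s)$ computes the same function as $f_s$ with probability $1$; $|\mathcal O(f_s)|\le p(|f_s|)$ for some polynomial $p$; and for every PPT $A$ there is an oracle PPT $S$ such that for every predicate $\pi$, every $k$ and every auxiliary input $z$ of length at most $\mathrm{poly}(k)$, $$\bigl|\Pr[A(\mathcal O(f_s),z)=\pi(s,z)]-\Pr[S^{f_s}(z)=\pi(s,z)]\bigr|\le\mathrm{negl}(k),$$ over uniform $s\in\{0,1\}^k$ and the coins of $\mathcal O$, $A$ and $S$. A PPT algorithm $i\mathcal O$ is an indistinguishability obfuscator for a class $\bigcup_k\mathcal K_k$ of circuits if it satisfies the same correctness and polynomial-size conditions on the class and if, for every PPT $D$, $|\Pr[D(i\mathcal O(C))=1]-\Pr[D(i\mathcal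 O(C'))=1]|\le\mathrm{negl}(k)$ for all $C,C'\in\mathcal K_k$ of the same size that compute the same function. **Puncturable PRFs.** A one-bit puncturable PRF with input length $n(k)$ is a family of functions $G_s\colon\{0,1\}^{n(k)}\to\{0,1\}$, $s\in\{0,1\}^k$, computable in polynomial time, with a PPT key sampler $\mathrm{Gen}(1^k)\in\{0,1\}^k$ and a (possibly randomized) puncturing map $\mathrm{Punc}$ that takes $s$ and a point $x^*\in\{0,1\}^{n(k)}$ to a punctured key $\sigma$ of polynomial length, from which functions $G_\sigma$ can be evaluated in polynomial time, such that, for $s\leftarrow\mathrm{Gen}(1^k)$ and $\sigma\leftarrow\mathrm{Punc}(s,x^*)$: $G_\sigma(x)=G_s(x)$ for all $x\ne x^*$ with probability $1$; and $(x^*,\sigma,G_s(x^*))$ and $(x^*,\sigma,u)$ with $u\in\{0,1\}$ uniform are computationally indistinguishable for PPT distinguishers, uniformly in $x^*$. **The circuits to be obfuscated.** Given a polynomial $m$, sets $I_k\subseteq\{0,1\}^{\ell(k)}$ of size $t(k)$, and a one-bit puncturable PRF $G$ with input length $\ell'(k)\,t(k)$, let $K_s$ and $K^*_{\sigma,x^*}$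 be polynomial-size circuits, efficiently computable from the hardwired data $s$, respectively $(\sigma,x^*)$, that take as input a circuit $\tilde C\colon\{0,1\}^{\ell(k)}\to\{0,1\}^{\ell'(k)}$ of size $m(k)$ and compute the following, with $\tilde C(I_k)=(\tilde C(i))_{i\in I_k}$: $K_s(\tilde C)=G_s(\tilde C(I_k))$; and $K^*_{\sigma,x^*}(\tilde C)=G_\sigma(\tilde C(I_k))$ if $\tilde C(I_k)\ne x^*$, while $K^*_{\sigma,x^*}(\tilde C)=0$ if $\tilde C(I_k)=x^*$. Let $d(k)$ be a polynomially bounded upper bound for their sizes, and let $[\mathcal K\cup\mathcal K^*]_d$ be the class of all the circuits $K_s$ with $s\in\{0,1\}^k$ and $K^*_{\sigma,x^*}$ with $\sigma$ a possible value of $\mathrm{Punc}(s,x^*)$, $s\in\{0,1\}^k$, $x^*\in\{0,1\}^{\ell'(k)t(k)}$, padded with zeros to size $d(k)$. **Theorem.** Let $\mathcal C$ have super-polynomial pseudo-entropy. Assume that for every polynomial $m$ there are sets $I_k$ of polynomial size on which $\mathcal C$ has pseudo-entropy at least $m(k)+k$, a one-bit puncturable PRF $G$ with input length $\ell'(k)\,t(k)$,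 where $t(k)=|I_k|$, and circuits $K_s$, $K^*_{\sigma,x^*}$ as above, such that there is an indistinguishability obfuscator for the class $[\mathcal K\cup\mathcal K^*]_d$. Then $\mathcal C$ has no average-case VBB obfuscator with independent auxiliary inputs. -/

import Mathlib

noncomputable section

/-- Bit strings of length `n`. -/
abbrev Bits (n : ℕ) : Type := Fin n → Bool

/-- `f` is bounded by a polynomial. -/
def PolyBounded (f : ℕ → ℕ) : Prop :=
  ∃ p : Polynomial ℕ, ∀ k, f k ≤ p.eval k

/-- `ε` is negligible: it decays faster than every inverse polynomial. -/
def Negligible (ε : ℕ → ℝ) : Prop :=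
  Asymptotics.SuperpolynomialDecay Filter.atTop (fun k : ℕ => (k : ℝ)) ε

/-- The probability that a random bit equals `1`. -/
def prOne (p : PMF Bool) : ℝ := (p true).toReal

/-! ### Boolean circuits as bit strings

A circuit with `n` inputs and `m` outputs, built from NAND gates of unbounded fan-in, is given by
the bit string that lists, gate after gate, the rows of its adjacency matrix. The wires are the
inputs `0, …, n - 1`, followed by the gates; gate `j` is wire `n + j`. Its row has `n + j + m` bits:
the first `n + j` say which of the earlier wires are inputs of the gate, and the last `m` say which
of the `m` output gates (again NAND gates) take gate `j` as an input. Bits beyond the end of the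
string count as `0`, so that every bit string is a circuit, and appending zeros to it does not
change the function that it computes. The size of a circuit is the length of this string. -/

/-- A circuit, described by a bit string. Its size is the length of the string. -/
abbrev Circuit : Type := List Bool

namespace Circuit

/-- The position of the first bit of the row of gate `j`. -/
def rowStart (n m j : ℕ) : ℕ := ∑ i ∈ Finset.range j, (n + i + m)

/-- Whether wire `a` is an input of gate `j`. -/
def sel (n m : ℕ) (C : Circuit) (j a : ℕ) : Bool := C.getD (rowStart n m j + a) false

/-- Whether gate `j` is an input of the output gate `o`. -/
def flag (n m : ℕ) (C : Circuit) (j o : ℕ) : Bool := C.getD (rowStart n m j + (n + j) + o) false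

/-- The values of the inputs and of the first `j` gates. -/
def wires (n m : ℕ) (C : Circuit) (x : Bits n) : ℕ → List Bool
  | 0 => List.ofFn x
  | j + 1 =>
    let v := wires n m C x j
    v ++ [!((List.range (n + j)).all fun a => !(sel n m C j a) || v.getD a false)]

/-- The function `{0,1}ⁿ → {0,1}ᵐ` computed by a circuit. (A string of length `L` has fewer than
`L + 1` gates that lead to an output.) -/
def eval (n m : ℕ) (C : Circuit) (x : Bits n) : Bits m := fun o =>
  !((List.range C.length).all fun j =>
      !(flag n m C j o) || (wires n m C x C.length).getD (n + j) false)

/-- The circuit `C`, of size at most `d`, padded with zeros to size `d`. -/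
def padTo (d : ℕ) (C : Circuit) : Bits d := fun i => C.getD i false

end Circuit

/-! ### Non-uniform probabilistic polynomial-time algorithms

A non-uniform algorithm is a family of randomized circuits of polynomial size, possibly with oracle
gates: one circuit for each value of the security parameter and of the lengths of the inputs. -/

/-- A gate of an oracle circuit; `ws` lists the wires that it reads. -/
inductive OGate : Type
  /-- A NAND gate of arbitrary fan-in. -/
  | nand (ws : List ℕ) : OGate
  /-- An oracle gate, which appends the answer to the query to the list of wires. -/
  | query (ws : List ℕ) : OGate

/-- The cost of a gate. -/
def OGate.cost : OGate → ℕ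
  | nand ws => 1 + ws.length
  | query ws => 1 + ws.length

/-- Append the output of a gate to the list `v` of the values of the wires so far. -/
def OGate.step {a b : ℕ} (f : Bits a → Bits b) (v : List Bool) : OGate → List Bool
  | nand ws => v ++ [!(ws.all fun i => v.getD i false)]
  | query ws => v ++ List.ofFn (f fun i => (ws.map fun j => v.getD j false).getD i false)

/-- A randomized oracle circuit with `m` output bits. -/
structure OCircuit (m : ℕ) : Type where
  /-- The number of random bits. -/
  coins : ℕ
  /-- The gates, in the order of evaluation. -/
  gates : List OGate
  /-- The wires that carry the output. -/
  out : Fin m → ℕ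

namespace OCircuit

/-- The size of an oracle circuit. -/
def size {m : ℕ} (A : OCircuit m) : ℕ := A.coins + m + (A.gates.map OGate.cost).sum

/-- The output on oracle `f`, input `x` and random bits `r`. -/
def output {m a b : ℕ} (A : OCircuit m) (f : Bits a → Bits b) (x : List Bool)
    (r : Bits A.coins) : Bits m :=
  fun i => (A.gates.foldl (OGate.step f) (x ++ List.ofFn r)).getD (A.out i) false

/-- The distribution of the output on oracle `f` and input `x`. -/
def run {m a b : ℕ} (A : OCircuit m) (f : Bits a → Bits b) (x : List Bool) : PMF (Bits m) :=
  (PMF.uniformOfFintype (Bits A.coins)).map (A.output f x)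

/-- The distribution of the output on input `x`, without an oracle
(queries to the empty oracle return nothing). -/
def runPlain {m : ℕ} (A : OCircuit m) (x : List Bool) : PMF (Bits m) :=
  A.run (id : Bits 0 → Bits 0) x

/-- `run` for a circuit with a single output bit. -/
def runBit {a b : ℕ} (A : OCircuit 1) (f : Bits a → Bits b) (x : List Bool) : PMF Bool :=
  (A.run f x).map fun y => y 0

/-- `runPlain` for a circuit with a single output bit. -/
def runPlainBit (A : OCircuit 1) (x : List Bool) : PMF Bool :=
  (A.runPlain x).map fun y => y 0

end OCircuit

/-- A family of circuits, one for each security parameter, has polynomial size. -/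
def PPT {m : ℕ → ℕ} (A : ∀ k, OCircuit (m k)) : Prop :=
  PolyBounded fun k => (A k).size

/-- Polynomial size, for algorithms with one input: `n` is its length. -/
def PPT₁ {m : ℕ → ℕ → ℕ} (A : ∀ k n, OCircuit (m k n)) : Prop :=
  ∃ q : Polynomial ℕ, ∀ k n, (A k n).size ≤ q.eval (k + n)

/-- Polynomial size, for algorithms with two inputs: `n` and `n'` are their lengths. -/
def PPT₂ {m : ℕ → ℕ → ℕ → ℕ} (A : ∀ k n n', OCircuit (m k n n')) : Prop :=
  ∃ q : Polynomial ℕ, ∀ k n n', (A k n n').size ≤ q.eval (k + n + n')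

/-- `g` is computable by deterministic circuits of polynomial size. -/
def EffComputable {a b : ℕ → ℕ} (g : ∀ k, Bits (a k) → Bits (b k)) : Prop :=
  ∃ A : ∀ k, OCircuit (b k), PPT A ∧
    ∀ k x, (A k).runPlain (List.ofFn x) = PMF.pure (g k x)

/-- `EffComputable` for functions of two arguments. -/
def EffComputable₂ {a a' b : ℕ → ℕ} (g : ∀ k, Bits (a k) → Bits (a' k) → Bits (b k)) : Prop :=
  ∃ A : ∀ k, OCircuit (b k), PPT A ∧
    ∀ k x y, (A k).runPlain (List.ofFn x ++ List.ofFn y) = PMF.pure (g k x y)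

/-! ### Circuit families and virtual black box obfuscation -/

/-- A family `{f_s}` of polynomial-size circuits, with `f_s : {0,1}^{ℓ(k)} → {0,1}^{ℓ'(k)}` for
every `s ∈ {0,1}^k`. A random member for the security parameter `k` is `f_s` for a uniform `s`. -/
structure CircuitFamily : Type where
  /-- The input length `ℓ(k)`. -/
  inLen : ℕ → ℕ
  /-- The output length `ℓ'(k)`. -/
  outLen : ℕ → ℕ
  /-- The circuit `f_s`. -/
  circ : ∀ k, Bits k → Circuit
  inLen_poly : PolyBounded inLen
  outLen_poly : PolyBounded outLen
  circ_poly : ∃ q : Polynomial ℕ, ∀ k s, (circ k s).length ≤ q.eval k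

namespace CircuitFamily

variable (F : CircuitFamily)

/-- The function computed by `f_s`. -/
def fn (k : ℕ) (s : Bits k) : Bits (F.inLen k) → Bits (F.outLen k) :=
  Circuit.eval (F.inLen k) (F.outLen k) (F.circ k s)

/-- With probability 1, `O(f_s)` computes the same function as `f_s`. -/
def ObfCorrect (O : ℕ → Circuit → PMF Circuit) : Prop :=
  ∀ k s, ∀ C ∈ (O k (F.circ k s)).support, Circuit.eval (F.inLen k) (F.outLen k) C = F.fn k s

/-- The size of `O(f_s)` is at most polynomial in the size of `f_s`. -/
def ObfSlowdown (O : ℕ → Circuit → PMF Circuit) : Prop :=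
  ∃ p : Polynomial ℕ, ∀ k s, ∀ C ∈ (O k (F.circ k s)).support,
    C.length ≤ p.eval (F.circ k s).length

/-- The event `A(O(f_s), aux) = π(s, aux)`, for uniform `s`. -/
def realExp (O : ℕ → Circuit → PMF Circuit) (A : ℕ → ℕ → ℕ → OCircuit 1) (k : ℕ)
    (π : Bits k → List Bool → Bool) (aux : List Bool) : PMF Bool :=
  (PMF.uniformOfFintype (Bits k)).bind fun s =>
    (O k (F.circ k s)).bind fun C =>
      ((A k C.length aux.length).runPlainBit (C ++ aux)).map fun b => b == π s aux

/-- The event `S^{f_s}(aux) = π(s, aux)`, for uniform `s`. -/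
def idealExp (S : ℕ → ℕ → OCircuit 1) (k : ℕ)
    (π : Bits k → List Bool → Bool) (aux : List Bool) : PMF Bool :=
  (PMF.uniformOfFintype (Bits k)).bind fun s =>
    ((S k aux.length).runBit (F.fn k s) aux).map fun b => b == π s aux

/-- Average-case virtual black box security with independent auxiliary input. -/
def SecureIndependentAux (O : ℕ → Circuit → PMF Circuit) : Prop :=
  ∀ A : ℕ → ℕ → ℕ → OCircuit 1, PPT₂ A →
    ∃ S : ℕ → ℕ → OCircuit 1, PPT₁ S ∧
      ∀ a : Polynomial ℕ, ∃ ε : ℕ → ℝ, Negligible ε ∧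
        ∀ (k : ℕ) (π : Bits k → List Bool → Bool) (aux : List Bool), aux.length ≤ a.eval k →
          |prOne (F.realExp O A k π aux) - prOne (F.idealExp S k π aux)| ≤ ε k

/-- `O` is an average-case virtual black box obfuscator of the family with independent auxiliary
inputs. `O` is an arbitrary randomized map of circuits to circuits; it need not be efficient. -/
def IsAverageCaseObfuscator (O : ℕ → Circuit → PMF Circuit) : Prop :=
  F.ObfCorrect O ∧ F.ObfSlowdown O ∧ F.SecureIndependentAux O

/-! ### Pseudo-entropy -/

/-- The family has pseudo-entropy at least `p` on the sets `I_k` of polynomial size `t(k)`, where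
`I k` enumerates `I_k` without repetition. The oracle `f_s ∘ Y` agrees with `f_s` off `I_k` and
with `Y` on `I_k`. The lower bound on the min-entropy is asymptotic: for small `k` no random
variable with values in a fixed finite set could satisfy it for all polynomials `p`. -/
def PseudoEntropicOn (p : ℕ → ℕ) (t : ℕ → ℕ) (I : ∀ k, Fin (t k) → Bits (F.inLen k)) : Prop :=
  PolyBounded t ∧ (∀ k, Function.Injective (I k)) ∧
    ∃ Y : ∀ k, Bits k → PMF (Fin (t k) → Bits (F.outLen k)),
      (∀ᶠ k in Filter.atTop, ∀ s y, Y k s y ≤ (2 ^ p k : ENNReal)⁻¹) ∧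
      ∀ D : ℕ → OCircuit 1, PPT D →
        Negligible fun k =>
          |prOne ((PMF.uniformOfFintype (Bits k)).bind fun s => (D k).runBit (F.fn k s) []) -
            prOne ((PMF.uniformOfFintype (Bits k)).bind fun s => (Y k s).bind fun y =>
              (D k).runBit (Function.extend (I k) y (F.fn k s)) [])|

/-- The family has pseudo-entropy at least `p` for every polynomial `p`. -/
def SuperPolyPseudoEntropy : Prop :=
  ∀ p : Polynomial ℕ, ∃ (t : ℕ → ℕ) (I : ∀ k, Fin (t k) → Bits (F.inLen k)),
    F.PseudoEntropicOn (fun k => p.eval k) t I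

end CircuitFamily

/-! ### Puncturable pseudo-random functions -/

/-- A puncturable pseudo-random function family `G_s : {0,1}^{n(k)} → {0,1}^{l(k)}` with keys
`s ∈ {0,1}^k`. A punctured key is a string of polynomial length. Nothing more is asked of the
puncturing map; in particular it may be randomized. -/
structure PuncturablePRF (n l : ℕ → ℕ) : Type where
  /-- The value `G_s(x)`. -/
  eval : ∀ k, Bits k → Bits (n k) → Bits (l k)
  /-- The key sampler. -/
  gen : ∀ k, PMF (Bits k)
  /-- The length of punctured keys. -/
  pkLen : ℕ → ℕ
  /-- The puncturing algorithm. -/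
  punc : ∀ k, Bits k → Bits (n k) → PMF (Bits (pkLen k))
  /-- Evaluation with a punctured key. -/
  evalPunc : ∀ k, Bits (pkLen k) → Bits (n k) → Bits (l k)
  n_poly : PolyBounded n
  l_poly : PolyBounded l
  pkLen_poly : PolyBounded pkLen
  eval_eff : EffComputable₂ eval
  evalPunc_eff : EffComputable₂ evalPunc
  gen_eff : ∃ A : ∀ k, OCircuit k, PPT A ∧ ∀ k, (A k).runPlain [] = gen k
  /-- Functionality is preserved under puncturing. -/
  functionality : ∀ k x', ∀ s ∈ (gen k).support, ∀ σ ∈ (punc k s x').support,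
    ∀ x, x ≠ x' → evalPunc k σ x = eval k s x
  /-- Indistinguishability at punctured points. -/
  indist : ∀ D : ℕ → OCircuit 1, PPT D → ∃ ε : ℕ → ℝ, Negligible ε ∧
    ∀ (k : ℕ) (x' : Bits (n k)),
      |prOne ((gen k).bind fun s => (punc k s x').bind fun σ =>
          (D k).runPlainBit (List.ofFn x' ++ List.ofFn σ ++ List.ofFn (eval k s x'))) -
        prOne ((gen k).bind fun s => (punc k s x').bind fun σ =>
          (PMF.uniformOfFintype (Bits (l k))).bind fun u =>
            (D k).runPlainBit (List.ofFn x' ++ List.ofFn σ ++ List.ofFn u))| ≤ ε k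

/-! ### Indistinguishability obfuscation -/

/-- The efficient randomized algorithm `iO`, whose output on a circuit of size `n` is a circuit of
size `L k n`, is an indistinguishability obfuscator for the class `⋃ₖ cls k` of circuits with
`a k` inputs and `b k` outputs. -/
structure IsIndistinguishabilityObfuscator (a b : ℕ → ℕ) (cls : ℕ → Set Circuit)
    (L : ℕ → ℕ → ℕ) (iO : ∀ k n, OCircuit (L k n)) : Prop where
  efficient : PPT₁ iO
  correct : ∀ k, ∀ C ∈ cls k, ∀ C' ∈ ((iO k C.length).runPlain C).support,
    Circuit.eval (a k) (b k) (List.ofFn C') = Circuit.eval (a k) (b k) C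
  slowdown : ∃ p : Polynomial ℕ, ∀ k, ∀ C ∈ cls k, L k C.length ≤ p.eval C.length
  indist : ∀ D : ℕ → ℕ → OCircuit 1, PPT₁ D → ∃ ε : ℕ → ℝ, Negligible ε ∧
    ∀ k, ∀ C ∈ cls k, ∀ C' ∈ cls k, C.length = C'.length →
      Circuit.eval (a k) (b k) C = Circuit.eval (a k) (b k) C' →
        |prOne (((iO k C.length).runPlain C).bind fun z =>
            (D k (L k C.length)).runPlainBit (List.ofFn z)) -
          prOne (((iO k C'.length).runPlain C').bind fun z =>
            (D k (L k C'.length)).runPlainBit (List.ofFn z))| ≤ ε k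

/-! ### The circuits to be obfuscated -/

/-- The concatenation of `t` strings of length `b`. -/
def flatten {t b : ℕ} (y : Fin t → Bits b) : Bits (t * b) := fun i => y i.divNat i.modNat

/-- The string `C(I) = (C(i))_{i ∈ I}`, for a circuit `C : {0,1}^a → {0,1}^b` of size `m`. -/
def valuesOn {a t : ℕ} (b : ℕ) {m : ℕ} (I : Fin t → Bits a) (C : Bits m) : Bits (t * b) :=
  flatten fun i => Circuit.eval a b (List.ofFn C) (I i)

/-- An implementation of the circuits `K_s` (hardwired: a key `s` of the one-bit puncturable
pseudo-random function `G`) and `K*_{σ,x*}` (hardwired: a punctured key `σ` and the point `x*`) by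
circuits of size at most `d(k)`. The input of either is a circuit `C` of size `m(k)`:
`K_s` returns `G_s(C(I_k))`, and `K*_{σ,x*}` returns `G_σ(C(I_k))` if `C(I_k) ≠ x*`, and `0`
otherwise. As the keys are hardwired, the padded circuits are efficiently computable from them. -/
structure KeyedCircuits (a b m t : ℕ → ℕ) (I : ∀ k, Fin (t k) → Bits (a k))
    (G : PuncturablePRF (fun k => t k * b k) (fun _ => 1)) : Type where
  /-- The bound `d(k)` for the size of the circuits. -/
  d : ℕ → ℕ
  /-- The circuit `K_s`. -/
  K : ∀ k, Bits k → Circuit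
  /-- The circuit `K*_{σ,x*}`. -/
  Kstar : ∀ k, Bits (G.pkLen k) → Bits (t k * b k) → Circuit
  d_poly : PolyBounded d
  K_size : ∀ k s, (K k s).length ≤ d k
  Kstar_size : ∀ k σ x', (Kstar k σ x').length ≤ d k
  K_spec : ∀ k s (C : Bits (m k)),
    Circuit.eval (m k) 1 (K k s) C = G.eval k s (valuesOn (b k) (I k) C)
  Kstar_spec : ∀ k σ x' (C : Bits (m k)),
    Circuit.eval (m k) 1 (Kstar k σ x') C =
      if valuesOn (b k) (I k) C = x' then fun _ => false
      else G.evalPunc k σ (valuesOn (b k) (I k) C)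
  K_eff : EffComputable fun k s => (K k s).padTo (d k)
  Kstar_eff : EffComputable₂ fun k σ x' => (Kstar k σ x').padTo (d k)

/-- The class of all circuits `K_s` and `K*_{σ,x*}`, padded with zeros to size `d(k)`, where
`s ∈ {0,1}^k`, and where `σ` is obtained from a key in `{0,1}^k` by puncturing it at `x*`. -/
def KeyedCircuits.cls {a b m t : ℕ → ℕ} {I : ∀ k, Fin (t k) → Bits (a k)}
    {G : PuncturablePRF (fun k => t k * b k) (fun _ => 1)} (𝒦 : KeyedCircuits a b m t I G)
    (k : ℕ) : Set Circuit :=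
  {C | ∃ s, C = List.ofFn ((𝒦.K k s).padTo (𝒦.d k))} ∪
    {C | ∃ s x', ∃ σ ∈ (G.punc k s x').support, C = List.ofFn ((𝒦.Kstar k σ x').padTo (𝒦.d k))}

end

/-!
Suppose that `O` obfuscates the family, and let `m` bound the size of `O(f_s)`. The attacker gets an
auxiliary input `z`, reads it as a circuit that takes descriptions of circuits of size `m`, and
returns `z(O(f_s))` (`exists_attacker`). If `z` is an obfuscation of the keyed circuit `K_{s'}`, this
is `G_{s'}(f_s(I))`, with probability 1, so the simulator has to compute `G_{s'}(f_s(I))` from oracle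
access to `f_s` and from `z`, up to a negligible error.

The simulator cannot do so. Whether it succeeds can be tested with oracle access to `f_s`, so by
pseudo-entropy it succeeds almost as often on the oracle `f_s ∘ Y`, where it has to find `G_{s'}(Y)`.
There are at most `2 ^ m` strings `C(I)` with `C` of size `m`, and `Y` has min-entropy `m + k`, so `Y`
is such a string with probability at most `2 ^ (-k)` (`sum_valuesOn_le`). Otherwise the circuits
`K_{s'}` and `K*_{σ,Y}` compute the same function, where `σ` is the key `s'` punctured at `Y`
(`KeyedCircuits.eval_padTo_K_eq_Kstar`). Fix such a `y` and `s`, for which the simulator succeeds with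
probability more than `3 / 4`. Indistinguishability obfuscation replaces `K_{s'}` by `K*_{σ,y}`, and
then the security of the puncturable function replaces `G_{s'}(y)` by an independent random bit, which
is guessed with probability `1 / 2` (`guess_le`). This is a contradiction.

The distinguishers in this argument have to be circuits of polynomial size, put together from the
given ones. For this, `Derives` says that some bits can be computed from others at a certain cost,
where a bit is identified with the function of oracle, input and coins that it computes. Derivations
compose like functions, a given circuit can be run inside a derivation (`Derives.output`), with its
oracle replaced by a hardwired function (`implements_extend`) if need be, and a derivation is turned
back into a circuit at the end (`Derives.exists_ocircuit`).
-/

noncomputable section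

/-! ### Polynomial bounds -/

/-- `f` is bounded by a polynomial in the size parameter `sz`. -/
def PolyIn {ι : Type*} (sz f : ι → ℕ) : Prop :=
  ∃ q : Polynomial ℕ, ∀ i, f i ≤ q.eval (sz i)

theorem Polynomial.eval_nat_mono (q : Polynomial ℕ) : Monotone fun x => q.eval x := by
  intro x y h
  simp only [Polynomial.eval_eq_sum_range]
  gcongr

namespace PolyIn

variable {ι : Type*} {sz f g : ι → ℕ}

theorem mono (h : PolyIn sz g) (hfg : ∀ i, f i ≤ g i) : PolyIn sz f :=
  h.imp fun _ hq i => (hfg i).trans (hq i)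

theorem const (c : ℕ) : PolyIn sz fun _ => c := ⟨Polynomial.C c, fun i => by simp⟩

theorem self : PolyIn sz sz := ⟨Polynomial.X, fun i => by simp⟩

theorem add (hf : PolyIn sz f) (hg : PolyIn sz g) : PolyIn sz fun i => f i + g i := by
  obtain ⟨p, hp⟩ := hf
  obtain ⟨q, hq⟩ := hg
  exact ⟨p + q, fun i => by simpa using add_le_add (hp i) (hq i)⟩

theorem mul (hf : PolyIn sz f) (hg : PolyIn sz g) : PolyIn sz fun i => f i * g i := by
  obtain ⟨p, hp⟩ := hf
  obtain ⟨q, hq⟩ := hg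
  exact ⟨p * q, fun i => by simpa using Nat.mul_le_mul (hp i) (hq i)⟩

theorem comp (h : PolyIn g f) (hg : PolyIn sz g) : PolyIn sz f := by
  obtain ⟨p, hp⟩ := h
  obtain ⟨q, hq⟩ := hg
  refine ⟨p.comp q, fun i => (hp i).trans ?_⟩
  rw [Polynomial.eval_comp]
  exact p.eval_nat_mono (hq i)

end PolyIn

theorem Negligible.tendsto {ε : ℕ → ℝ} (h : Negligible ε) :
    Filter.Tendsto ε Filter.atTop (nhds 0) := by
  simpa using h 0

/-! ### Deriving wires from wires -/

section Derives

variable {Γ : Type} {a b : ℕ}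

/-- `OGate.step` for wires that depend on a parameter `γ : Γ` (oracle, input and random bits). -/
def OGate.symStep (f : Γ → Bits a → Bits b) (W : List (Γ → Bool)) : OGate → List (Γ → Bool)
  | nand ws => W ++ [fun γ => !(ws.all fun i => (W.map (· γ)).getD i false)]
  | query ws => W ++ List.ofFn fun j γ =>
      f γ (fun i => (ws.map fun l => (W.map (· γ)).getD l false).getD i false) j

theorem OGate.map_symStep (f : Γ → Bits a → Bits b) (W : List (Γ → Bool)) (g : OGate) (γ : Γ) :
    (g.symStep f W).map (· γ) = g.step (f γ) (W.map (· γ)) := by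
  cases g <;> simp [symStep, step, List.map_ofFn, Function.comp_def]

theorem OGate.map_foldl_symStep (f : Γ → Bits a → Bits b) (gs : List OGate) (γ : Γ) :
    ∀ W : List (Γ → Bool),
      (gs.foldl (symStep f) W).map (· γ) = gs.foldl (step (f γ)) (W.map (· γ)) := by
  induction gs with
  | nil => simp
  | cons g gs ih => intro W; simp only [List.foldl_cons, ih, map_symStep]

theorem OGate.mem_symStep (f : Γ → Bits a → Bits b) {W : List (Γ → Bool)} {φ : Γ → Bool}
    (g : OGate) (h : φ ∈ W) : φ ∈ g.symStep f W := by
  cases g <;> simp [symStep, h]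

theorem OGate.mem_foldl_symStep (f : Γ → Bits a → Bits b) {φ : Γ → Bool} (gs : List OGate) :
    ∀ {W : List (Γ → Bool)}, φ ∈ W → φ ∈ gs.foldl (symStep f) W := by
  induction gs with
  | nil => simp
  | cons g gs ih => intro W h; exact ih (mem_symStep f g h)

/-- Gates of total cost at most `c`, with oracle `f`, turn any list of wires that carries all bits
in `K` into one that carries all bits in `S`. A bit is a function of the parameter `γ : Γ`. Referring
to bits by what they compute, not by wire numbers, makes circuits compose without renumbering. -/
def Derives (f : Γ → Bits a → Bits b) (c : ℕ) (K S : Set (Γ → Bool)) : Prop :=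
  ∀ W : List (Γ → Bool), (∀ φ ∈ K, φ ∈ W) →
    ∃ gs : List OGate, (gs.map OGate.cost).sum ≤ c ∧ ∀ φ ∈ S, φ ∈ gs.foldl (OGate.symStep f) W

/-- The coordinates of a bit string that depends on a parameter. -/
def coords {m : ℕ} (φ : Γ → Bits m) : Set (Γ → Bool) := Set.range fun i γ => φ γ i

/-- The two constant bits. -/
def constBits (Γ : Type) : Set (Γ → Bool) := {fun _ => false, fun _ => true}

theorem mem_constBits (c : Bool) : (fun _ => c) ∈ constBits Γ := by
  cases c <;> simp [constBits]

theorem coords_subset {m : ℕ} {φ : Γ → Bits m} {S : Set (Γ → Bool)} :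
    coords φ ⊆ S ↔ ∀ i, (fun γ => φ γ i) ∈ S := by
  simp [coords, Set.range_subset_iff]

namespace Derives

variable {f : Γ → Bits a → Bits b} {c c' : ℕ} {K K' S S' : Set (Γ → Bool)}

theorem of_subset (h : S ⊆ K) : Derives f 0 K S :=
  fun _ hW => ⟨[], by simp, fun φ hφ => hW φ (h hφ)⟩

theorem mono (h : Derives f c K S) (hK : K ⊆ K') (hc : c ≤ c') (hS : S' ⊆ S) :
    Derives f c' K' S' := fun W hW => by
  obtain ⟨gs, h1, h2⟩ := h W fun φ hφ => hW φ (hK hφ)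
  exact ⟨gs, h1.trans hc, fun φ hφ => h2 φ (hS hφ)⟩

theorem trans (h : Derives f c K S) (h' : Derives f c' (K ∪ S) S') :
    Derives f (c + c') K (S ∪ S') := fun W hW => by
  obtain ⟨gs, h1, h2⟩ := h W hW
  obtain ⟨gs', h1', h2'⟩ := h' (gs.foldl (OGate.symStep f) W) (by
    rintro φ (hφ | hφ)
    · exact OGate.mem_foldl_symStep f gs (hW φ hφ)
    · exact h2 φ hφ)
  refine ⟨gs ++ gs', by simpa using add_le_add h1 h1', ?_⟩
  rw [List.foldl_append]
  rintro φ (hφ | hφ)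
  · exact OGate.mem_foldl_symStep f gs' (h2 φ hφ)
  · exact h2' φ hφ

/-- The intermediate bits of `trans` are forgotten. -/
theorem comp (h : Derives f c K S) (h' : Derives f c' (K ∪ S) S') : Derives f (c + c') K S' :=
  (h.trans h').mono subset_rfl le_rfl Set.subset_union_right

theorem union (h : Derives f c K S) (h' : Derives f c' K S') : Derives f (c + c') K (S ∪ S') :=
  h.trans (h'.mono Set.subset_union_left le_rfl subset_rfl)

/-- Steps in sequence, each of which may use what the earlier ones derived. -/
theorem iterate {T : ℕ → Set (Γ → Bool)} (n : ℕ)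
    (h : ∀ j < n, Derives f c (K ∪ ⋃ i < j, T i) (T j)) : Derives f (n * c) K (⋃ i < n, T i) := by
  induction n with
  | zero => exact (of_subset (by simp)).mono subset_rfl (by simp) subset_rfl
  | succ n ih =>
    refine ((ih fun j hj => h j (hj.trans n.lt_succ_self)).trans (h n n.lt_succ_self)).mono
      subset_rfl (by rw [Nat.succ_mul]) ?_
    intro φ hφ
    simp only [Set.mem_iUnion] at hφ
    obtain ⟨i, hi, hφ⟩ := hφ
    rcases Nat.lt_succ_iff_lt_or_eq.mp hi with hi | rfl
    · exact Or.inl (Set.mem_iUnion₂.mpr ⟨i, hi, hφ⟩)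
    · exact Or.inr hφ

theorem forall_lt {T : ℕ → Set (Γ → Bool)} (n : ℕ) (h : ∀ j < n, Derives f c K (T j)) :
    Derives f (n * c) K (⋃ i < n, T i) :=
  iterate n fun j hj => (h j hj).mono Set.subset_union_left le_rfl subset_rfl

theorem forall_fin {n : ℕ} {T : Fin n → Set (Γ → Bool)} (h : ∀ j, Derives f c K (T j)) :
    Derives f (n * c) K (⋃ i, T i) := by
  refine (forall_lt (T := fun j => ⋃ hj : j < n, T ⟨j, hj⟩) n fun j hj => (h ⟨j, hj⟩).mono
    subset_rfl le_rfl ?_).mono subset_rfl le_rfl ?_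
  · simp [hj]
  · exact Set.iUnion_subset fun i φ hφ => Set.mem_iUnion₂.mpr ⟨i, i.2, by simpa using hφ⟩

theorem coords_fin {m : ℕ} {φ : Γ → Bits m} (h : ∀ i, Derives f c K {fun γ => φ γ i}) :
    Derives f (m * c) K (coords φ) :=
  (forall_fin h).mono subset_rfl le_rfl (coords_subset.mpr fun i => Set.mem_iUnion.mpr ⟨i, rfl⟩)

open Classical in
theorem exists_index {W : List (Γ → Bool)} {φ : Γ → Bool} (h : φ ∈ W) (γ : Γ) :
    (W.map (· γ)).getD (W.idxOf φ) false = φ γ := by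
  have h1 := List.idxOf_lt_length_of_mem h
  rw [List.getD_eq_getElem _ _ (by simpa using h1)]
  simp

theorem nand (l : List (Γ → Bool)) (h : ∀ φ ∈ l, φ ∈ K) :
    Derives f (1 + l.length) K {fun γ => !(l.all fun φ => φ γ)} := fun W hW => by
  classical
  refine ⟨[.nand (l.map W.idxOf)], by simp [OGate.cost], ?_⟩
  rintro _ rfl
  simp only [List.foldl_cons, List.foldl_nil, OGate.symStep, List.mem_append, List.mem_singleton]
  right
  funext γ
  rw [List.all_map]
  congr 1
  rw [Bool.eq_iff_iff, List.all_eq_true, List.all_eq_true]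
  refine forall₂_congr fun φ hφ => ?_
  rw [Function.comp_apply, exists_index (hW φ (h φ hφ))]

theorem not {φ : Γ → Bool} (h : φ ∈ K) : Derives f 2 K {fun γ => !(φ γ)} := by
  simpa using nand (f := f) [φ] (by simpa using h)

theorem nand₂ {φ ψ : Γ → Bool} (h : φ ∈ K) (h' : ψ ∈ K) :
    Derives f 3 K {fun γ => !(φ γ && ψ γ)} := by
  simpa using nand (f := f) [φ, ψ] (by simp [h, h'])

theorem beq {φ ψ : Γ → Bool} (h : φ ∈ K) (h' : ψ ∈ K) :
    Derives f 14 K {fun γ => φ γ == ψ γ} := by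
  have h1 := nand₂ (f := f) h h'
  have h2 := h1.trans ((nand₂ (f := f) (φ := φ) (ψ := fun γ => !(φ γ && ψ γ))
    (Or.inl h) (Or.inr rfl)).union
    (nand₂ (f := f) (φ := ψ) (ψ := fun γ => !(φ γ && ψ γ)) (Or.inl h') (Or.inr rfl)))
  have h3 := h2.comp (nand₂ (φ := fun γ => !(φ γ && !(φ γ && ψ γ)))
    (ψ := fun γ => !(ψ γ && !(φ γ && ψ γ))) (by simp) (by simp))
  have h4 := h3.comp (not (Or.inr rfl))
  refine h4.mono subset_rfl le_rfl ?_
  rintro _ rfl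
  funext γ
  cases φ γ <;> cases ψ γ <;> rfl

theorem consts : Derives f 3 K (constBits Γ) := by
  have h1 : Derives f 1 K {fun _ => false} := by simpa using nand (f := f) (K := K) [] (by simp)
  refine (h1.trans (not (Or.inr rfl))).mono subset_rfl le_rfl ?_
  rintro _ (rfl | rfl)
  · exact Or.inl rfl
  · exact Or.inr rfl

theorem query {x : Γ → Bits a} (h : coords x ⊆ K) :
    Derives f (1 + a) K (coords fun γ => f γ (x γ)) := fun W hW => by
  classical
  refine ⟨[.query (List.ofFn fun i => W.idxOf fun γ => x γ i)], by simp [OGate.cost], ?_⟩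
  rintro _ ⟨j, rfl⟩
  simp only [List.foldl_cons, List.foldl_nil, OGate.symStep, List.mem_append, List.mem_ofFn]
  refine Or.inr ⟨j, ?_⟩
  funext γ
  congr 1
  funext i
  rw [List.map_ofFn, List.getD_eq_getElem _ _ (by simp)]
  simp only [List.getElem_ofFn, Function.comp_apply]
  exact exists_index (hW _ (coords_subset.mp h i)) γ

end Derives

/-! ### Running a circuit inside another one -/

/-- Gates of cost `c`, with oracle `f`, evaluate the function `g` (which may depend on the
parameter) at any argument that is available, given the bits in `K`. -/
def Implements {a' b' : ℕ} (f : Γ → Bits a → Bits b) (c : ℕ) (K : Set (Γ → Bool))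
    (g : Γ → Bits a' → Bits b') : Prop :=
  ∀ x : Γ → Bits a', Derives f c (K ∪ coords x) (coords fun γ => g γ (x γ))

theorem Implements.mono {a' b' c : ℕ} {f : Γ → Bits a → Bits b} {K K' : Set (Γ → Bool)}
    {g : Γ → Bits a' → Bits b'} (h : Implements f c K g) (hK : K ⊆ K') : Implements f c K' g :=
  fun x => (h x).mono (Set.union_subset_union_left _ hK) le_rfl subset_rfl

theorem implements_oracle (f : Γ → Bits a → Bits b) (K : Set (Γ → Bool)) :
    Implements f (1 + a) K f :=
  fun _ => Derives.query Set.subset_union_right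

theorem implements_empty {a' : ℕ} (f : Γ → Bits a → Bits b) (K : Set (Γ → Bool))
    (g : Γ → Bits a' → Bits 0) : Implements f 0 K g :=
  fun _ => Derives.of_subset (coords_subset.mpr fun i => i.elim0)

theorem Derives.foldl_symStep {f : Γ → Bits a → Bits b} {a' b' c : ℕ} {g : Γ → Bits a' → Bits b'}
    (gs : List OGate) : ∀ {K : Set (Γ → Bool)} {V : List (Γ → Bool)},
    Implements f c K g → constBits Γ ⊆ K → (∀ φ ∈ V, φ ∈ K) →
    Derives f ((gs.map OGate.cost).sum * (1 + c)) K {φ | φ ∈ gs.foldl (OGate.symStep g) V} := by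
  induction gs with
  | nil =>
    intro K V _ _ hV
    exact (Derives.of_subset fun φ hφ => hV φ hφ).mono subset_rfl (by simp) subset_rfl
  | cons γ₀ gs ih =>
    intro K V hg hK hV
    have read : ∀ i, (fun γ => (V.map (· γ)).getD i false) ∈ K := by
      intro i
      by_cases hi : i < V.length
      · convert hV _ (List.getElem_mem hi) using 1
        funext γ
        rw [List.getD_eq_getElem _ _ (by simpa using hi)]
        simp
      · convert hK (mem_constBits false) using 1
        funext γ
        rw [List.getD_eq_default _ _ (by simpa using hi)]
    have step : Derives f (γ₀.cost * (1 + c)) K {φ | φ ∈ γ₀.symStep g V} := by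
      cases γ₀ with
      | nand ws =>
        refine ((Derives.of_subset (K := K) (S := {φ | φ ∈ V}) hV).union
          (Derives.nand (f := f) (ws.map fun i γ => (V.map (· γ)).getD i false)
            (by simpa using fun i _ => read i))).mono subset_rfl ?_ ?_
        · simp only [List.length_map, OGate.cost]; nlinarith
        · intro φ hφ
          simpa [OGate.symStep, List.all_map, Function.comp_def, or_comm] using hφ
      | query ws =>
        set x : Γ → Bits a' := fun γ i =>
          (ws.map fun l => (V.map (· γ)).getD l false).getD i false with hx
        have hxK : coords x ⊆ K := coords_subset.mpr fun i => by
          by_cases hi : (i : ℕ) < ws.length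
          · convert read ws[(i : ℕ)] using 1
            funext γ
            rw [hx]
            simp only
            rw [List.getD_eq_getElem _ _ (by simpa using hi)]
            simp
          · convert hK (mem_constBits false) using 1
            funext γ
            rw [hx]
            simp only
            rw [List.getD_eq_default _ _ (by simpa using hi)]
        have hq : Derives f c K (coords fun γ => g γ (x γ)) :=
          (hg x).mono (Set.union_subset subset_rfl hxK) le_rfl subset_rfl
        refine ((Derives.of_subset (K := K) (S := {φ | φ ∈ V}) hV).union hq).mono subset_rfl ?_ ?_
        · simp only [OGate.cost]; nlinarith
        · intro φ hφ
          simp only [OGate.symStep, Set.mem_ofPred_eq, List.mem_append, List.mem_ofFn] at hφ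
          exact hφ
    refine (step.comp (ih (V := γ₀.symStep g V) (hg.mono Set.subset_union_left)
      (hK.trans Set.subset_union_left) fun φ hφ => Or.inr hφ)).mono subset_rfl ?_ subset_rfl
    simp only [List.map_cons, List.sum_cons, add_mul]
    exact le_rfl

/-- A circuit is simulated by its own gates; each oracle gate costs as much as implementing its
oracle. -/
theorem Derives.output {f : Γ → Bits a → Bits b} {a' b' c m : ℕ} {g : Γ → Bits a' → Bits b'}
    {K : Set (Γ → Bool)} (A : OCircuit m) (hg : Implements f c K g) (hK : constBits Γ ⊆ K)
    {X : List (Γ → Bool)} (hX : ∀ φ ∈ X, φ ∈ K) {R : Γ → Bits A.coins} (hR : coords R ⊆ K) :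
    Derives f (A.size * (1 + c)) K (coords fun γ => A.output (g γ) (X.map (· γ)) (R γ)) := by
  have h := Derives.foldl_symStep (V := X ++ List.ofFn fun i γ => R γ i) A.gates hg hK (by
    intro φ hφ
    rcases List.mem_append.mp hφ with hφ | hφ
    · exact hX φ hφ
    · obtain ⟨i, rfl⟩ := (List.mem_ofFn' _ _).mp hφ
      exact coords_subset.mp hR i)
  have h' := h.comp (Derives.of_subset (f := f)
    (S := coords fun γ => A.output (g γ) (X.map (· γ)) (R γ)) ?_)
  · refine h'.mono subset_rfl ?_ subset_rfl
    rw [add_zero]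
    exact Nat.mul_le_mul_right _ (by simp [OCircuit.size])
  · refine coords_subset.mpr fun i => ?_
    set W := A.gates.foldl (OGate.symStep g) (X ++ List.ofFn fun i γ => R γ i) with hW
    have hval : (fun γ => A.output (g γ) (X.map (· γ)) (R γ) i) =
        fun γ => (W.map (· γ)).getD (A.out i) false := by
      funext γ
      rw [hW, OGate.map_foldl_symStep, List.map_append, List.map_ofFn]
      rfl
    rw [hval]
    by_cases hi : A.out i < W.length
    · refine Or.inr (show _ ∈ W from ?_)
      convert List.getElem_mem hi using 1
      funext γ
      rw [List.getD_eq_getElem _ _ (by simpa using hi)]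
      simp
    · refine Or.inl (hK ?_)
      convert mem_constBits false using 1
      funext γ
      rw [List.getD_eq_default _ _ (by simpa using hi)]

end Derives

/-! ### The universal circuit -/

namespace Circuit

theorem length_wires (n m : ℕ) (C : Circuit) (x : Bits n) (j : ℕ) :
    (wires n m C x j).length = n + j := by
  induction j with
  | zero => simp [wires]
  | succ j ih => simp [wires, ih]; omega

theorem wires_prefix (n m : ℕ) (C : Circuit) (x : Bits n) {i j : ℕ} (h : i ≤ j) :
    wires n m C x i <+: wires n m C x j := by
  induction j, h using Nat.le_induction with
  | base => exact List.prefix_rfl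
  | succ j _ ih => exact ih.trans (List.prefix_append _ _)

theorem getD_wires_of_le (n m : ℕ) (C : Circuit) (x : Bits n) {i j l : ℕ} (h : i ≤ j)
    (hl : l < n + i) : (wires n m C x j).getD l false = (wires n m C x i).getD l false := by
  obtain ⟨t, ht⟩ := wires_prefix n m C x h
  rw [← ht, List.getD_append _ _ _ _ (by rwa [length_wires])]

theorem getD_wires_input (n m : ℕ) (C : Circuit) (x : Bits n) (j : ℕ) (i : Fin n) :
    (wires n m C x j).getD i false = x i := by
  rw [getD_wires_of_le n m C x (Nat.zero_le j) (by simp), wires,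
    List.getD_eq_getElem _ _ (by simp)]
  simp

/-- The value of gate `j`, in terms of the values of the wires of the whole circuit. -/
theorem getD_wires_gate (n m : ℕ) (C : Circuit) (x : Bits n) {j L : ℕ} (h : j < L) :
    (wires n m C x L).getD (n + j) false =
      !((List.range (n + j)).all fun a =>
        !(sel n m C j a) || (wires n m C x L).getD a false) := by
  rw [getD_wires_of_le n m C x (Nat.succ_le_of_lt h) (by omega), wires,
    List.getD_append_right _ _ _ _ (by rw [length_wires]), length_wires, Nat.sub_self]
  simp only [List.getD_cons_zero]
  rw [Bool.eq_iff_iff, Bool.not_eq_true', Bool.not_eq_true', ← Bool.not_eq_true,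
    ← Bool.not_eq_true, List.all_eq_true, List.all_eq_true]
  refine not_congr (forall₂_congr fun a ha => ?_)
  rw [getD_wires_of_le n m C x h.le (List.mem_range.mp ha)]

theorem le_rowStart (n m j : ℕ) (hm : 0 < m) : j ≤ rowStart n m j := by
  rw [rowStart]
  calc j = ∑ i ∈ Finset.range j, 1 := by simp
    _ ≤ _ := Finset.sum_le_sum fun i _ => by omega

theorem getD_padTo {d : ℕ} {C : Circuit} (h : C.length ≤ d) (i : ℕ) :
    (List.ofFn (padTo d C)).getD i false = C.getD i false := by
  by_cases hi : i < d
  · rw [List.getD_eq_getElem _ _ (by simpa using hi)]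
    simp [padTo]
  · rw [List.getD_eq_default _ _ (by simpa using hi), List.getD_eq_default _ _ (by omega)]

theorem wires_padTo (n m : ℕ) {d : ℕ} {C : Circuit} (h : C.length ≤ d) (x : Bits n) (j : ℕ) :
    wires n m (List.ofFn (padTo d C)) x j = wires n m C x j := by
  induction j with
  | zero => rfl
  | succ j ih => simp only [wires, ih, sel, getD_padTo h]

/-- Padding does not change the function that a circuit computes. -/
theorem eval_padTo (n m : ℕ) {d : ℕ} {C : Circuit} (h : C.length ≤ d) :
    eval n m (List.ofFn (padTo d C)) = eval n m C := by
  funext x o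
  have hm : 0 < m := o.pos
  have hflag : ∀ j, C.length ≤ j → flag n m C j o = false := fun j hj =>
    List.getD_eq_default _ _ (by have := le_rowStart n m j hm; omega)
  simp only [eval, wires_padTo n m h, List.length_ofFn]
  congr 1
  rw [Bool.eq_iff_iff, List.all_eq_true, List.all_eq_true]
  have hf : ∀ j, flag n m (List.ofFn (padTo d C)) j o = flag n m C j o :=
    fun j => getD_padTo h _
  simp only [hf, List.mem_range]
  constructor
  · intro H j hj
    rw [← getD_wires_of_le n m C x h (by omega)]
    exact H j (by omega)
  · intro H j hj
    by_cases hjC : j < C.length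
    · rw [getD_wires_of_le n m C x h (by omega)]
      exact H j hjC
    · simp [hflag j (by omega)]

end Circuit

section Derives

variable {Γ : Type} {a b : ℕ} {f : Γ → Bits a → Bits b} {K : Set (Γ → Bool)}

/-- A bit of a string that is available; bits beyond the end are `0`. -/
theorem getD_ofFn_mem {L : ℕ} {C : Γ → Bits L} (hK : constBits Γ ⊆ K) (hC : coords C ⊆ K) (i : ℕ) :
    (fun γ => (List.ofFn (C γ)).getD i false) ∈ K := by
  by_cases hi : i < L
  · convert coords_subset.mp hC ⟨i, hi⟩ using 2 with γ
    rw [List.getD_eq_getElem _ _ (by simpa using hi)]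
    simp
  · convert hK (mem_constBits false) using 2 with γ
    rw [List.getD_eq_default _ _ (by simpa using hi)]

/-- Padding or truncating an available string takes no gates. -/
theorem coords_padTo_subset {L d : ℕ} {C : Γ → Bits L} (hK : constBits Γ ⊆ K) (hC : coords C ⊆ K) :
    coords (fun γ => Circuit.padTo d (List.ofFn (C γ))) ⊆ K :=
  coords_subset.mpr fun i => getD_ofFn_mem hK hC i

/-- One gate of the universal circuit: `N` wires `w`, of which those with `s j` are selected. -/
theorem Derives.selectedNand (N : ℕ) {s w : ℕ → Γ → Bool} (hs : ∀ j < N, s j ∈ K)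
    (hw : ∀ j < N, w j ∈ K) :
    Derives f (N * 5 + (1 + N)) K
      {fun γ => !((List.range N).all fun j => !(s j γ) || w j γ)} := by
  have h1 : ∀ j < N, Derives f 5 K {fun γ => !(s j γ) || w j γ} := fun j hj => by
    refine ((Derives.not (hw j hj)).comp
      (Derives.nand₂ (Or.inl (hs j hj)) (Or.inr rfl))).mono subset_rfl le_rfl ?_
    rintro _ rfl
    simp
  refine ((Derives.forall_lt N h1).comp (Derives.nand
    ((List.range N).map fun j γ => !(s j γ) || w j γ) ?_)).mono subset_rfl (by simp) ?_
  · simp only [List.mem_map, List.mem_range]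
    rintro _ ⟨j, hj, rfl⟩
    exact Or.inr (Set.mem_iUnion₂.mpr ⟨j, hj, rfl⟩)
  · rintro _ rfl
    simp [List.all_map, Function.comp_def]

/-- A bound for the cost of the gates of a universal circuit for circuits of size `L` with `n`
inputs and `m` outputs. -/
def universalCost (n m L : ℕ) : ℕ := (L + m) * (6 * (n + L) + 1)

theorem PolyIn.universalCost {ι : Type*} {sz n m L : ι → ℕ} (hn : PolyIn sz n) (hm : PolyIn sz m)
    (hL : PolyIn sz L) : PolyIn sz fun i => universalCost (n i) (m i) (L i) :=
  (hL.add hm).mul (((PolyIn.const 6).mul (hn.add hL)).add (PolyIn.const 1))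

/-- A universal circuit evaluates a circuit given by its description. -/
theorem Derives.eval {n m L : ℕ} {C : Γ → Bits L} {x : Γ → Bits n} (hK : constBits Γ ⊆ K)
    (hC : coords C ⊆ K) (hx : coords x ⊆ K) :
    Derives f (universalCost n m L) K
      (coords fun γ => Circuit.eval n m (List.ofFn (C γ)) (x γ)) := by
  set w : ℕ → Γ → Bool := fun l γ =>
    (Circuit.wires n m (List.ofFn (C γ)) (x γ) L).getD l false with hw
  have hin : ∀ l < n, w l ∈ K := fun l hl => by
    convert coords_subset.mp hx ⟨l, hl⟩ using 2 with γ
    exact Circuit.getD_wires_input n m _ _ L ⟨l, hl⟩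
  have hgates : Derives f (L * (6 * (n + L) + 1)) K (⋃ j < L, {w (n + j)}) := by
    refine Derives.iterate L fun j hj => ?_
    refine (Derives.selectedNand (n + j)
      (s := fun l γ => Circuit.sel n m (List.ofFn (C γ)) j l) (w := w)
      (fun l _ => Or.inl (getD_ofFn_mem hK hC _)) fun l hl => ?_).mono subset_rfl (by omega) ?_
    · by_cases hln : l < n
      · exact Or.inl (hin l hln)
      · refine Or.inr (Set.mem_iUnion₂.mpr ⟨l - n, by omega, ?_⟩)
        rw [Nat.add_sub_cancel' (by omega)]
        rfl
    · rintro _ rfl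
      rw [Set.mem_singleton_iff]
      funext γ
      exact Circuit.getD_wires_gate n m _ _ hj
  refine (hgates.comp (Derives.coords_fin (c := 6 * (n + L) + 1) fun o => ?_)).mono subset_rfl
    (by rw [universalCost, add_mul]) subset_rfl
  refine (Derives.selectedNand L
      (s := fun j γ => Circuit.flag n m (List.ofFn (C γ)) j o) (w := fun j => w (n + j))
      (fun l _ => Or.inl (getD_ofFn_mem hK hC _)) fun l hl => ?_).mono subset_rfl (by omega) ?_
  · exact Or.inr (Set.mem_iUnion₂.mpr ⟨l, hl, rfl⟩)
  · rintro _ rfl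
    rw [Set.mem_singleton_iff]
    funext γ
    simp [Circuit.eval, hw]

/-! ### Hardwired oracles -/

theorem coords_const_subset (hK : constBits Γ ⊆ K) {m : ℕ} (y : Bits m) :
    coords (fun _ : Γ => y) ⊆ K :=
  coords_subset.mpr fun i => hK (mem_constBits (y i))

/-- A function that is computed by a circuit and then overridden on `t` points can be hardwired. -/
theorem implements_extend {n m t : ℕ} (hK : constBits Γ ⊆ K) (C : Circuit)
    (I : Fin t → Bits n) (hI : Function.Injective I) (y : Fin t → Bits m) :
    Implements f (universalCost n m C.length + (n * 2 + (t * (1 + n) + m * (2 * t + 4)))) K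
      (fun _ => Function.extend I y (Circuit.eval n m C)) := by
  intro x
  set e : Γ → Bits m := fun γ => Circuit.eval n m C (x γ)
  have h1 : Derives f (universalCost n m C.length) (K ∪ coords x) (coords e) := by
    have := Derives.eval (f := f) (m := m) (C := fun _ => C.get) (x := x) (K := K ∪ coords x)
      (hK.trans Set.subset_union_left)
      (coords_const_subset (hK.trans Set.subset_union_left) _) Set.subset_union_right
    simpa using this
  have h2 : Derives f (n * 2) (K ∪ coords x) (coords fun γ i => !(x γ i)) :=
    Derives.coords_fin fun i => Derives.not (Or.inr ⟨i, rfl⟩)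
  -- the argument differs from the `i`-th point
  set ne : Γ → Bits t := fun γ i => !decide (x γ = I i) with hne
  have h3 : Derives f (t * (1 + n)) (K ∪ coords x ∪ coords fun γ i => !(x γ i)) (coords ne) := by
    refine Derives.coords_fin fun i => ?_
    refine (Derives.nand (List.ofFn fun l γ => x γ l == I i l) ?_).mono subset_rfl (by simp) ?_
    · intro φ hφ
      obtain ⟨l, rfl⟩ := (List.mem_ofFn' _ _).mp hφ
      cases hl : I i l
      · exact Or.inr ⟨l, by simp [hl]⟩
      · exact Or.inl (Or.inr ⟨l, by simp [hl]⟩)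
    · rintro _ rfl
      rw [Set.mem_singleton_iff]
      funext γ
      simp only [hne]
      congr 1
      rw [Bool.eq_iff_iff, List.all_eq_true, decide_eq_true_iff, funext_iff]
      simp
  refine (h1.trans ((h2.comp h3).mono Set.subset_union_left le_rfl subset_rfl)).comp
    (Derives.coords_fin (c := 2 * t + 4) fun j => ?_) |>.mono subset_rfl (by omega) subset_rfl
  -- bit `j` of the result is `(e j ∧ ⋀ i, ne i) ∨ ⋁ {i | y i j}, ¬ ne i`
  have hene : ∀ i, (fun γ => ne γ i) ∈ K ∪ coords x ∪ (coords e ∪ coords ne) :=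
    fun i => Or.inr (Or.inr ⟨i, rfl⟩)
  have h4 := Derives.nand (f := f) (K := K ∪ coords x ∪ (coords e ∪ coords ne))
    ((fun γ => e γ j) :: List.ofFn fun i γ => ne γ i) (by
      intro φ hφ
      rcases List.mem_cons.mp hφ with rfl | hφ
      · exact Or.inr (Or.inl ⟨j, rfl⟩)
      · obtain ⟨i, rfl⟩ := (List.mem_ofFn' _ _).mp hφ
        exact hene i)
  refine (h4.comp (Derives.nand ((fun γ => !(((fun γ => e γ j) ::
    List.ofFn fun i γ => ne γ i).all fun φ => φ γ)) ::
      List.ofFn fun i γ => !(y i j) || ne γ i) ?_)).mono subset_rfl (by simp; omega) ?_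
  · intro φ hφ
    rcases List.mem_cons.mp hφ with rfl | hφ
    · exact Or.inr rfl
    · obtain ⟨i, rfl⟩ := (List.mem_ofFn' _ _).mp hφ
      cases hy : y i j
      · exact Or.inl (Or.inl (Or.inl (hK (by simpa [hy] using mem_constBits true))))
      · exact Or.inl (by simpa [hy] using hene i)
  · rintro _ rfl
    rw [Set.mem_singleton_iff]
    funext γ
    by_cases hx : ∃ i, I i = x γ
    · obtain ⟨i, hi⟩ := hx
      beta_reduce
      rw [← hi, hI.extend_apply]
      have hall : ∀ i', ne γ i' = !decide (i' = i) := fun i' => by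
        simp [hne, ← hi, hI.eq_iff, eq_comm]
      rw [Bool.eq_iff_iff]
      simp [hall]
    · beta_reduce
      rw [Function.extend_apply' _ _ _ hx]
      have hall : ∀ i', ne γ i' = true := fun i' => by
        simpa [hne] using fun h => hx ⟨i', h.symm⟩
      have hne' : ((List.ofFn fun i γ => ne γ i).all fun φ => φ γ) = true := by
        simp [List.all_eq_true, hall]
      have hyne : ((List.ofFn fun i γ => !(y i j) || ne γ i).all fun φ => φ γ) = true := by
        simp [List.all_eq_true, hall]
      simp [hne', hyne, e]

/-! ### From derivations to circuits -/

/-- A derivation from the input bits `X i` and `r` coins is a randomized circuit. The oracle and the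
input depend on a parameter `p`; one circuit serves all values of `p`. -/
theorem Derives.exists_ocircuit {P : Type} {n r m c : ℕ} (f : P → Bits a → Bits b)
    (X : Fin n → P → Bool) (φ : P → Bits r → Bits m)
    (h : Derives (Γ := P × Bits r) (fun γ => f γ.1) c
      (constBits _ ∪ coords (fun γ i => X i γ.1) ∪ coords Prod.snd)
      (coords fun γ => φ γ.1 γ.2)) :
    ∃ A : OCircuit m, A.size ≤ r + m + (c + 3) ∧ ∀ p,
      A.run (f p) (List.ofFn fun i => X i p) = (PMF.uniformOfFintype (Bits r)).map (φ p) := by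
  have h' := (Derives.consts (f := fun γ : P × Bits r => f γ.1)
    (K := coords (fun γ i => X i γ.1) ∪ coords Prod.snd)).comp
      (h.mono (by rw [Set.union_assoc, Set.union_comm]) le_rfl subset_rfl)
  obtain ⟨gs, hc, hgs⟩ := h' (List.ofFn (fun i γ => X i γ.1) ++ List.ofFn (fun i γ => γ.2 i)) (by
    rintro _ (⟨i, rfl⟩ | ⟨i, rfl⟩)
    · exact List.mem_append_left _ (by simp)
    · exact List.mem_append_right _ (by simp))
  choose out hout hφ using fun i => List.mem_iff_getElem.mp (hgs _ ⟨i, rfl⟩)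
  refine ⟨⟨r, gs, out⟩, by simp only [OCircuit.size]; omega, fun p => ?_⟩
  rw [OCircuit.run]
  congr 1
  funext ρ i
  rw [OCircuit.output]
  have := OGate.map_foldl_symStep (fun γ : P × Bits r => f γ.1) gs (p, ρ)
    (List.ofFn (fun i γ => X i γ.1) ++ List.ofFn (fun i γ => γ.2 i))
  simp only [List.map_append, List.map_ofFn, Function.comp_def] at this
  rw [← this, List.getD_eq_getElem _ _ (by simpa using hout i)]
  simpa using congrFun (hφ i) (p, ρ)

end Derives

/-! ### Acceptance probabilities -/

theorem prOne_le_one (p : PMF Bool) : prOne p ≤ 1 :=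
  ENNReal.toReal_le_of_le_ofReal zero_le_one (by simpa using p.coe_le_one true)

theorem prOne_pure_true : prOne (PMF.pure true) = 1 := by simp [prOne]

theorem PMF.bind_congr {α β : Type*} {p : PMF α} {h h' : α → PMF β}
    (H : ∀ a ∈ p.support, h a = h' a) : p.bind h = p.bind h' := by
  ext b
  rw [PMF.bind_apply, PMF.bind_apply]
  refine tsum_congr fun a => ?_
  by_cases ha : p a = 0
  · simp [ha]
  · rw [H a ((PMF.mem_support_iff _ _).mpr ha)]

theorem PMF.sum_toReal {α : Type*} [Fintype α] (p : PMF α) : ∑ a, (p a).toReal = 1 := by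
  rw [← ENNReal.toReal_sum fun a _ => p.apply_ne_top a, ← tsum_fintype (L := .unconditional α),
    p.tsum_coe]
  simp

theorem prOne_bind {α : Type*} [Fintype α] (p : PMF α) (h : α → PMF Bool) :
    prOne (p.bind h) = ∑ a, (p a).toReal * prOne (h a) := by
  rw [prOne, PMF.bind_apply, tsum_fintype, ENNReal.toReal_sum fun a _ =>
    ENNReal.mul_ne_top (p.apply_ne_top a) ((h a).apply_ne_top _)]
  simp [prOne]

/-- Acceptance probabilities that are close given every outcome of `p` are close on average. -/
theorem abs_prOne_bind_sub_le {α : Type*} [Fintype α] {p : PMF α} {h h' : α → PMF Bool} {ε : ℝ}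
    (H : ∀ a ∈ p.support, |prOne (h a) - prOne (h' a)| ≤ ε) :
    |prOne (p.bind h) - prOne (p.bind h')| ≤ ε := by
  rw [prOne_bind, prOne_bind, ← Finset.sum_sub_distrib]
  calc |∑ a, ((p a).toReal * prOne (h a) - (p a).toReal * prOne (h' a))|
      ≤ ∑ a, |(p a).toReal * prOne (h a) - (p a).toReal * prOne (h' a)| :=
        Finset.abs_sum_le_sum_abs _ _
    _ ≤ ∑ a, (p a).toReal * ε := by
        refine Finset.sum_le_sum fun a _ => ?_
        rw [← mul_sub, abs_mul, abs_of_nonneg ENNReal.toReal_nonneg]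
        by_cases ha : p a = 0
        · simp [ha]
        · exact mul_le_mul_of_nonneg_left (H a ((PMF.mem_support_iff _ _).mpr ha))
            ENNReal.toReal_nonneg
    _ = ε := by rw [← Finset.sum_mul, PMF.sum_toReal, one_mul]

theorem le_prOne_bind {α : Type*} [Fintype α] {p : PMF α} {h : α → PMF Bool} {v : ℝ}
    (H : ∀ a ∈ p.support, v ≤ prOne (h a)) : v ≤ prOne (p.bind h) := by
  rw [prOne_bind]
  calc v = ∑ a, (p a).toReal * v := by rw [← Finset.sum_mul, PMF.sum_toReal, one_mul]
    _ ≤ _ := by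
        refine Finset.sum_le_sum fun a _ => ?_
        by_cases ha : p a = 0
        · simp [ha]
        · exact mul_le_mul_of_nonneg_left (H a ((PMF.mem_support_iff _ _).mpr ha))
            ENNReal.toReal_nonneg

open Classical in
/-- A bound that may fail on a set `B` of small probability. -/
theorem prOne_bind_le_of_rare {α : Type*} [Fintype α] {p : PMF α} {h : α → PMF Bool} {v η : ℝ}
    (hv : 0 ≤ v) (B : Finset α) (hB : ∑ a ∈ B, (p a).toReal ≤ η)
    (H : ∀ a ∉ B, prOne (h a) ≤ v) : prOne (p.bind h) ≤ η + v := by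
  rw [prOne_bind]
  calc ∑ a, (p a).toReal * prOne (h a)
      ≤ ∑ a, ((if a ∈ B then (p a).toReal else 0) + (p a).toReal * v) := by
        refine Finset.sum_le_sum fun a _ => ?_
        have hp : 0 ≤ (p a).toReal := ENNReal.toReal_nonneg
        split_ifs with ha
        · nlinarith [prOne_le_one (h a)]
        · nlinarith [H a ha]
    _ = ∑ a ∈ B, (p a).toReal + v := by
        rw [Finset.sum_add_distrib, ← Finset.sum_mul, PMF.sum_toReal, one_mul]
        simp
    _ ≤ _ := by linarith

theorem prOne_bind_le {α : Type*} [Fintype α] {p : PMF α} {h : α → PMF Bool} {v : ℝ} (hv : 0 ≤ v)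
    (H : ∀ a, prOne (h a) ≤ v) : prOne (p.bind h) ≤ v := by
  simpa using prOne_bind_le_of_rare (p := p) hv ∅ (η := 0) (by simp) fun a _ => H a

/-- An independent uniform bit is guessed with probability `1/2`. -/
theorem prOne_guess (q : PMF Bool) :
    prOne ((PMF.uniformOfFintype (Bits 1)).bind fun u => q.map fun β => β == u 0) = 1 / 2 := by
  have h : ∀ c : Bool, prOne (q.map fun β => β == c) = (q c).toReal := fun c => by
    rw [prOne, PMF.map_apply, tsum_fintype]
    cases c <;> simp
  have hq := PMF.sum_toReal q
  rw [Fintype.sum_bool] at hq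
  rw [prOne_bind, ← (Equiv.funUnique (Fin 1) Bool).symm.sum_comp]
  simp [h]
  linarith

/-- A uniform string of length `n + m` consists of two independent uniform strings. -/
theorem uniform_append (n m : ℕ) :
    PMF.uniformOfFintype (Bits (n + m)) = (PMF.uniformOfFintype (Bits n)).bind fun u =>
      (PMF.uniformOfFintype (Bits m)).map fun v => Fin.append u v := by
  ext w
  rw [PMF.bind_apply, tsum_fintype, Finset.sum_eq_single (fun i => w (Fin.castAdd m i))]
  · rw [PMF.map_apply, tsum_fintype, Finset.sum_eq_single (fun i => w (Fin.natAdd n i))]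
    · rw [if_pos (by rw [Fin.append_castAdd_natAdd])]
      simp only [PMF.uniformOfFintype_apply, Fintype.card_pi, Fintype.card_bool, Finset.prod_const,
        Finset.card_univ, Fintype.card_fin, Nat.cast_pow]
      rw [pow_add, ENNReal.mul_inv (by simp) (by simp)]
    · intro v _ hv
      refine if_neg fun hw => hv ?_
      funext i
      rw [hw, Fin.append_right]
    · simp
  · intro u _ hu
    rw [PMF.map_apply, tsum_fintype]
    refine mul_eq_zero_of_right _ (Finset.sum_eq_zero fun v _ => if_neg ?_)
    intro hw
    refine hu ?_
    funext i
    rw [hw, Fin.append_left]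
  · simp

/-! ### Circuits for the attacker and the distinguishers -/

/-- If the output distribution is a point mass, the output is the same for all random bits. -/
theorem OCircuit.output_of_run_eq_pure {m a b : ℕ} {A : OCircuit m} {f : Bits a → Bits b}
    {x : List Bool} {y : Bits m} (h : A.run f x = PMF.pure y) (r : Bits A.coins) :
    A.output f x r = y := by
  have : A.output f x r ∈ (A.run f x).support := by
    rw [OCircuit.run, PMF.support_map]
    exact ⟨r, by simp, rfl⟩
  rwa [h, PMF.support_pure, Set.mem_singleton_iff] at this

section Derives

variable {Γ : Type} {a b : ℕ} {f : Γ → Bits a → Bits b} {K : Set (Γ → Bool)}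

/-- A circuit whose output does not depend on its random bits needs none. -/
theorem Derives.deterministic {m : ℕ} {A : OCircuit m} {g : Γ → Bits m} (hK : constBits Γ ⊆ K)
    {X : List (Γ → Bool)} (hX : ∀ φ ∈ X, φ ∈ K)
    (hA : ∀ γ, A.runPlain (X.map (· γ)) = PMF.pure (g γ)) : Derives f A.size K (coords g) := by
  have h := Derives.output (f := f) A (implements_empty f K fun _ => (id : Bits 0 → Bits 0)) hK hX
    (R := fun _ _ => false) (coords_const_subset hK _)
  simpa [OCircuit.output_of_run_eq_pure (hA _)] using h

theorem coords_comp_subset {m n : ℕ} {φ : Γ → Bits m} (h : coords φ ⊆ K) (e : Fin n → Fin m) :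
    coords (fun γ i => φ γ (e i)) ⊆ K :=
  coords_subset.mpr fun i => coords_subset.mp h (e i)

theorem forall_mem_ofFn {m : ℕ} {φ : Γ → Bits m} (h : coords φ ⊆ K) :
    ∀ ψ ∈ List.ofFn fun i γ => φ γ i, ψ ∈ K := by
  intro ψ hψ
  obtain ⟨i, rfl⟩ := (List.mem_ofFn' _ _).mp hψ
  exact coords_subset.mp h i

end Derives

/-- The attacker that applies the auxiliary input, read as a circuit, to the obfuscated circuit. -/
theorem exists_applyAux (M n n' : ℕ) : ∃ A : OCircuit 1, A.size ≤ universalCost M 1 n' + 4 ∧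
    ∀ C aux : List Bool, C.length = n → aux.length = n' →
      A.runPlainBit (C ++ aux) =
        PMF.pure (Circuit.eval M 1 aux (Circuit.padTo M C) 0) := by
  obtain ⟨A, hA, hrun⟩ := Derives.exists_ocircuit (P := Bits (n + n')) (r := 0)
    (fun _ => (id : Bits 0 → Bits 0)) (fun i p => p i)
    (fun p _ => Circuit.eval M 1 (List.ofFn fun i => p (Fin.natAdd n i))
      (Circuit.padTo M (List.ofFn fun i => p (Fin.castAdd n' i))))
    (Derives.eval (fun φ h => Or.inl (Or.inl h))
      (C := fun γ : Bits (n + n') × Bits 0 => fun i => γ.1 (Fin.natAdd n i))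
      (x := fun γ => Circuit.padTo M (List.ofFn fun i => γ.1 (Fin.castAdd n' i)))
      (coords_comp_subset (fun φ h => Or.inl (Or.inr h)) _)
      (coords_padTo_subset (fun φ h => Or.inl (Or.inl h))
        (coords_comp_subset (φ := fun γ : Bits (n + n') × Bits 0 => γ.1)
          (fun φ h => Or.inl (Or.inr h)) _)))
  refine ⟨A, by omega, ?_⟩
  rintro C aux rfl rfl
  have h := hrun (Fin.append C.get aux.get)
  rw [List.ofFn_fin_append] at h
  simp only [List.ofFn_get, Fin.append_left, Fin.append_right] at h
  rw [OCircuit.runPlainBit, OCircuit.runPlain, h]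
  rw [PMF.map_comp]
  exact PMF.map_const _ _

/-- The attackers of `exists_applyAux` form a family of polynomial size. -/
theorem exists_attacker (M : Polynomial ℕ) : ∃ A : ℕ → ℕ → ℕ → OCircuit 1, PPT₂ A ∧
    ∀ (k : ℕ) (C aux : Circuit), (A k C.length aux.length).runPlainBit (C ++ aux) =
      PMF.pure (Circuit.eval (M.eval k) 1 aux (Circuit.padTo (M.eval k) C) 0) := by
  choose A hA hrun using fun k n n' => exists_applyAux (M.eval k) n n'
  refine ⟨A, ?_, fun k C aux => hrun k _ _ C aux rfl rfl⟩
  have hk : PolyIn (fun p : ℕ × ℕ × ℕ => p.1 + p.2.1 + p.2.2) fun p => p.1 :=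
    PolyIn.self.mono fun p => by omega
  have hn : PolyIn (fun p : ℕ × ℕ × ℕ => p.1 + p.2.1 + p.2.2) fun p => p.2.2 :=
    PolyIn.self.mono fun p => by omega
  have hM : PolyIn (fun p : ℕ × ℕ × ℕ => p.1) fun p => M.eval p.1 := ⟨M, fun _ => le_rfl⟩
  obtain ⟨q, hq⟩ := (((hM.comp hk).universalCost (PolyIn.const 1) hn).add (PolyIn.const 4)).mono
    fun p => hA p.1 p.2.1 p.2.2
  exact ⟨q, fun k n n' => hq (k, n, n')⟩

/-- The oracle distinguisher: obfuscate `κ s` for a random key `s`, run the simulator `B` on the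
result, and accept if its guess is the value `G s` at the oracle's values on `I`. -/
theorem exists_oracleTest {k d L a b t : ℕ} {gen : PMF (Bits k)} {Agen : OCircuit k}
    (hgen : Agen.runPlain [] = gen) {κ : Bits k → Bits d} {Aκ : OCircuit d}
    (hκ : ∀ s, Aκ.runPlain (List.ofFn s) = PMF.pure (κ s))
    {G : Bits k → Bits (t * b) → Bits 1} {AG : OCircuit 1}
    (hG : ∀ s x, AG.runPlain (List.ofFn s ++ List.ofFn x) = PMF.pure (G s x))
    (Aobf : OCircuit L) (B : OCircuit 1) (I : Fin t → Bits a) :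
    ∃ D : OCircuit 1, D.size ≤ 2 * Agen.size + Aκ.size + 2 * Aobf.size + B.size * (3 + a) +
        t * (1 + a) + AG.size + 18 ∧
      ∀ f : Bits a → Bits b, D.runBit f [] = gen.bind fun s =>
        (Aobf.runPlain (List.ofFn (κ s))).bind fun z =>
          (B.runBit f (List.ofFn z)).map fun β => β == G s (flatten fun i => f (I i)) 0 := by
  -- the coins of `Γ` are split among the sampler, the obfuscator and the simulator
  let Γ : Type := (Bits a → Bits b) × Bits (Agen.coins + Aobf.coins + B.coins)
  let s : Γ → Bits k := fun γ => Agen.output (id : Bits 0 → Bits 0) []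
    fun i => γ.2 (Fin.castAdd _ (Fin.castAdd _ i))
  let z : Γ → Bits L := fun γ => Aobf.output (id : Bits 0 → Bits 0) (List.ofFn (κ (s γ)))
    fun i => γ.2 (Fin.castAdd _ (Fin.natAdd _ i))
  let β : Γ → Bits 1 := fun γ => B.output γ.1 (List.ofFn (z γ)) fun i => γ.2 (Fin.natAdd _ i)
  let v : Γ → Bits (t * b) := fun γ => flatten fun i => γ.1 (I i)
  obtain ⟨D, hD, hrun⟩ := Derives.exists_ocircuit (P := Bits a → Bits b)
    (r := Agen.coins + Aobf.coins + B.coins) (n := 0) (m := 1)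
    (c := Agen.size + (Aκ.size + (Aobf.size + (B.size * (2 + a) + (t * (1 + a) +
      (AG.size + 14)))))) id (fun i => i.elim0)
    (fun p ρ _ => β (p, ρ) 0 == G (s (p, ρ)) (v (p, ρ)) 0) (by
      generalize hK : constBits _ ∪ _ ∪ _ = K
      have hc : constBits Γ ⊆ K := by rw [← hK]; exact fun φ h => Or.inl (Or.inl h)
      have hr : coords (fun γ : Γ => γ.2) ⊆ K := by
        rw [← hK]; exact Set.subset_union_right
      clear hK
      have h1 := Derives.output (f := fun γ : Γ => γ.1) (K := K) Agen (X := [])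
        (implements_empty _ _ fun _ => (id : Bits 0 → Bits 0)) hc (by simp)
        (coords_comp_subset hr fun i => Fin.castAdd _ (Fin.castAdd _ i))
      have h2 := Derives.deterministic (f := fun γ : Γ => γ.1) (K := K ∪ coords s) (A := Aκ)
        (g := fun γ => κ (s γ)) (hc.trans (by intro φ h; simp [h]))
        (forall_mem_ofFn (φ := s) (by intro φ h; simp [h]))
        (fun γ => by simpa [List.map_ofFn, Function.comp_def] using hκ (s γ))
      have h3 := Derives.output (f := fun γ : Γ => γ.1)
        (K := K ∪ coords s ∪ coords fun γ => κ (s γ)) Aobf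
        (implements_empty _ _ fun _ => (id : Bits 0 → Bits 0)) (hc.trans (by intro φ h; simp [h]))
        (forall_mem_ofFn (φ := fun γ => κ (s γ)) (by intro φ h; simp [h]))
        (coords_comp_subset (hr.trans (by intro φ h; simp [h]))
          fun i => Fin.castAdd _ (Fin.natAdd _ i))
      simp only [List.map_ofFn, Function.comp_def] at h3
      have h4 := Derives.output (f := fun γ : Γ => γ.1)
        (K := K ∪ coords s ∪ (coords fun γ => κ (s γ)) ∪ coords z) B
        (implements_oracle _ _) (hc.trans (by intro φ h; simp [h]))
        (forall_mem_ofFn (φ := z) (by intro φ h; simp [h]))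
        (coords_comp_subset (hr.trans (by intro φ h; simp [h])) fun i => Fin.natAdd _ i)
      simp only [List.map_ofFn, Function.comp_def] at h4
      have h5 : Derives (fun γ : Γ => γ.1) (t * (1 + a))
          (K ∪ coords s ∪ (coords fun γ => κ (s γ)) ∪ coords z ∪ coords β) (coords v) :=
        (Derives.forall_fin fun i => Derives.query (x := fun _ : Γ => I i) (coords_const_subset
          (hc.trans (by intro φ h; simp [h])) _)).mono subset_rfl le_rfl
          (coords_subset.mpr fun i => Set.mem_iUnion.mpr ⟨i.divNat, i.modNat, rfl⟩)
      have h6 := Derives.deterministic (f := fun γ : Γ => γ.1)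
        (K := K ∪ coords s ∪ (coords fun γ => κ (s γ)) ∪ coords z ∪ coords β ∪ coords v) (A := AG)
        (g := fun γ => G (s γ) (v γ)) (hc.trans (by intro φ h; simp [h]))
        (X := (List.ofFn fun i γ => s γ i) ++ List.ofFn fun i γ => v γ i)
        (by
          intro φ h
          rcases List.mem_append.mp h with h | h
          · exact forall_mem_ofFn (φ := s) (by intro φ h; simp [h]) φ h
          · exact forall_mem_ofFn (φ := v) (by intro φ h; simp [h]) φ h)
        (fun γ => by simpa [List.map_ofFn, Function.comp_def] using hG (s γ) (v γ))
      have h7 := Derives.beq (f := fun γ : Γ => γ.1)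
        (K := K ∪ coords s ∪ (coords fun γ => κ (s γ)) ∪ coords z ∪ coords β ∪ coords v ∪
          coords fun γ => G (s γ) (v γ))
        (φ := fun γ => β γ 0) (ψ := fun γ => G (s γ) (v γ) 0)
        (by simp only [Set.mem_union]; exact Or.inl (Or.inl (Or.inr ⟨0, rfl⟩)))
        (Or.inr ⟨0, rfl⟩)
      refine (h1.comp (h2.comp (h3.comp (h4.comp (h5.comp (h6.comp h7)))))).mono subset_rfl ?_ ?_
      · ring_nf; exact le_rfl
      · exact coords_subset.mpr fun _ => rfl)
  have h1 : Agen.coins ≤ Agen.size := by simp [OCircuit.size, add_assoc]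
  have h2 : Aobf.coins ≤ Aobf.size := by simp [OCircuit.size, add_assoc]
  have h3 : B.coins ≤ B.size := by simp [OCircuit.size, add_assoc]
  refine ⟨D, hD.trans (by rw [show 3 + a = 1 + (2 + a) by omega, mul_add B.size 1 (2 + a)]; omega),
    fun f => ?_⟩
  have h : D.run f [] = _ := hrun f
  rw [OCircuit.runBit, h, uniform_append, uniform_append, ← hgen]
  simp only [OCircuit.runBit, OCircuit.runPlain, OCircuit.run, PMF.map_bind, PMF.bind_map,
    PMF.bind_bind, PMF.map_comp, Function.comp_def, s, z, β, v, Fin.append_left, Fin.append_right]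

/-- The distinguisher for obfuscated circuits: run `B` on oracle `h`, which is hardwired, and
compare its guess with `c`. -/
theorem exists_hardwiredTest {n a b q : ℕ} {h : Bits a → Bits b}
    (hh : ∀ {Γ : Type} {K : Set (Γ → Bool)}, constBits Γ ⊆ K →
      Implements (fun _ => (id : Bits 0 → Bits 0)) q K fun _ => h) (B : OCircuit 1) (c : Bool) :
    ∃ D : OCircuit 1, D.size ≤ B.size * (2 + q) + 18 ∧
      ∀ z : Bits n, D.runPlainBit (List.ofFn z) =
        (B.runBit h (List.ofFn z)).map fun β => β == c := by
  let Γ : Type := Bits n × Bits B.coins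
  let β : Γ → Bits 1 := fun γ => B.output h (List.ofFn γ.1) γ.2
  obtain ⟨D, hD, hrun⟩ := Derives.exists_ocircuit (P := Bits n) (r := B.coins) (m := 1)
    (c := B.size * (1 + q) + 14) (fun _ => (id : Bits 0 → Bits 0)) (fun i p => p i)
    (fun p ρ _ => β (p, ρ) 0 == c) (by
      generalize hK : constBits _ ∪ _ ∪ _ = K
      have hc : constBits Γ ⊆ K := by rw [← hK]; exact fun φ h => Or.inl (Or.inl h)
      have hx : coords (fun γ : Γ => γ.1) ⊆ K := by rw [← hK]; exact fun φ h => Or.inl (Or.inr h)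
      have hr : coords (fun γ : Γ => γ.2) ⊆ K := by rw [← hK]; exact Set.subset_union_right
      clear hK
      have h1 := Derives.output (f := fun _ : Γ => (id : Bits 0 → Bits 0)) B (hh hc) hc
        (forall_mem_ofFn hx) hr
      simp only [List.map_ofFn, Function.comp_def] at h1
      exact (h1.comp (Derives.beq (φ := fun γ => β γ 0) (Or.inr ⟨0, rfl⟩)
        (Or.inl (hc (mem_constBits c))))).mono subset_rfl le_rfl (coords_subset.mpr fun _ => rfl))
  have h1 : B.coins ≤ B.size := by simp [OCircuit.size, add_assoc]
  refine ⟨D, hD.trans (by rw [show 2 + q = 1 + (1 + q) by omega, mul_add B.size 1 (1 + q)]; omega),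
    fun x => ?_⟩
  have h := hrun x
  rw [OCircuit.runPlainBit, OCircuit.runPlain, h]
  simp only [OCircuit.runBit, OCircuit.run, PMF.map_comp, Function.comp_def, β]

/-- The distinguisher for punctured keys `σ`: obfuscate `κ σ x`, run `B` on the result and the
hardwired oracle `h`, and compare its guess with the given bit. -/
theorem exists_puncturedTest {l n d L a b q : ℕ} {κ : Bits l → Bits n → Bits d} {Aκ : OCircuit d}
    (hκ : ∀ σ x, Aκ.runPlain (List.ofFn σ ++ List.ofFn x) = PMF.pure (κ σ x))
    {h : Bits a → Bits b}
    (hh : ∀ {Γ : Type} {K : Set (Γ → Bool)}, constBits Γ ⊆ K →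
      Implements (fun _ => (id : Bits 0 → Bits 0)) q K fun _ => h)
    (Aobf : OCircuit L) (B : OCircuit 1) :
    ∃ D : OCircuit 1, D.size ≤ Aκ.size + 2 * Aobf.size + B.size * (2 + q) + 18 ∧
      ∀ (x : Bits n) (σ : Bits l) (u : Bits 1),
        D.runPlainBit (List.ofFn x ++ List.ofFn σ ++ List.ofFn u) =
          (Aobf.runPlain (List.ofFn (κ σ x))).bind fun z =>
            (B.runBit h (List.ofFn z)).map fun β => β == u 0 := by
  let P : Type := Bits (n + l + 1)
  let Γ : Type := P × Bits (Aobf.coins + B.coins)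
  let x : Γ → Bits n := fun γ i => γ.1 (Fin.castAdd _ (Fin.castAdd _ i))
  let σ : Γ → Bits l := fun γ i => γ.1 (Fin.castAdd _ (Fin.natAdd _ i))
  let z : Γ → Bits L := fun γ => Aobf.output (id : Bits 0 → Bits 0) (List.ofFn (κ (σ γ) (x γ)))
    fun i => γ.2 (Fin.castAdd _ i)
  let β : Γ → Bits 1 := fun γ => B.output h (List.ofFn (z γ)) fun i => γ.2 (Fin.natAdd _ i)
  obtain ⟨D, hD, hrun⟩ := Derives.exists_ocircuit (P := P) (r := Aobf.coins + B.coins) (m := 1)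
    (c := Aκ.size + (Aobf.size + (B.size * (1 + q) + 14))) (fun _ => (id : Bits 0 → Bits 0))
    (fun i p => p i) (fun p ρ _ => β (p, ρ) 0 == p (Fin.natAdd _ 0)) (by
      generalize hK : constBits _ ∪ _ ∪ _ = K
      have hc : constBits Γ ⊆ K := by rw [← hK]; exact fun φ h => Or.inl (Or.inl h)
      have hp : coords (fun γ : Γ => γ.1) ⊆ K := by rw [← hK]; exact fun φ h => Or.inl (Or.inr h)
      have hr : coords (fun γ : Γ => γ.2) ⊆ K := by rw [← hK]; exact Set.subset_union_right
      clear hK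
      have h1 := Derives.deterministic (f := fun _ : Γ => (id : Bits 0 → Bits 0)) (K := K) (A := Aκ)
        (g := fun γ => κ (σ γ) (x γ)) hc
        (X := (List.ofFn fun i γ => σ γ i) ++ List.ofFn fun i γ => x γ i)
        (by
          intro φ h
          rcases List.mem_append.mp h with h | h
          · exact forall_mem_ofFn (φ := σ) (coords_comp_subset hp _) φ h
          · exact forall_mem_ofFn (φ := x) (coords_comp_subset hp _) φ h)
        (fun γ => by simpa [List.map_ofFn, Function.comp_def] using hκ (σ γ) (x γ))
      have h2 := Derives.output (f := fun _ : Γ => (id : Bits 0 → Bits 0))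
        (K := K ∪ coords fun γ => κ (σ γ) (x γ)) Aobf
        (implements_empty _ _ fun _ => (id : Bits 0 → Bits 0)) (hc.trans (by intro φ h; simp [h]))
        (forall_mem_ofFn (φ := fun γ => κ (σ γ) (x γ)) (by intro φ h; simp [h]))
        (coords_comp_subset (hr.trans (by intro φ h; simp [h])) fun i => Fin.castAdd _ i)
      simp only [List.map_ofFn, Function.comp_def] at h2
      have h3 := Derives.output (f := fun _ : Γ => (id : Bits 0 → Bits 0))
        (K := K ∪ (coords fun γ => κ (σ γ) (x γ)) ∪ coords z) B
        (hh (hc.trans (by intro φ h; simp [h]))) (hc.trans (by intro φ h; simp [h]))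
        (forall_mem_ofFn (φ := z) (by intro φ h; simp [h]))
        (coords_comp_subset (hr.trans (by intro φ h; simp [h])) fun i => Fin.natAdd _ i)
      simp only [List.map_ofFn, Function.comp_def] at h3
      have h4 := Derives.beq (f := fun _ : Γ => (id : Bits 0 → Bits 0))
        (K := K ∪ (coords fun γ => κ (σ γ) (x γ)) ∪ coords z ∪ coords β)
        (φ := fun γ => β γ 0) (ψ := fun γ => γ.1 (Fin.natAdd _ 0))
        (Or.inr ⟨0, rfl⟩) (Or.inl (Or.inl (Or.inl (coords_subset.mp hp _))))
      refine (h1.comp (h2.comp (h3.comp h4))).mono subset_rfl ?_ ?_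
      · ring_nf; exact le_rfl
      · exact coords_subset.mpr fun _ => rfl)
  have h2 : Aobf.coins ≤ Aobf.size := by simp [OCircuit.size, add_assoc]
  have h3 : B.coins ≤ B.size := by simp [OCircuit.size, add_assoc]
  refine ⟨D, hD.trans (by rw [show 2 + q = 1 + (1 + q) by omega, mul_add B.size 1 (1 + q)]; omega),
    fun x' σ' u => ?_⟩
  have h := hrun (Fin.append (Fin.append x' σ') u)
  rw [List.ofFn_fin_append, List.ofFn_fin_append] at h
  rw [OCircuit.runPlainBit, OCircuit.runPlain, h, uniform_append]
  simp only [OCircuit.runBit, OCircuit.runPlain, OCircuit.run, PMF.map_bind, PMF.bind_map,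
    PMF.map_comp, Function.comp_def, x, σ, z, β, Fin.append_left, Fin.append_right]

/-! ### Values on `I` that no small circuit describes -/

theorem flatten_injective {t b : ℕ} : Function.Injective (flatten : (Fin t → Bits b) → _) := by
  intro y y' h
  funext i j
  have := congrFun h (finProdFinEquiv (i, j))
  have hd : (finProdFinEquiv (i, j)).divNat = i ∧ (finProdFinEquiv (i, j)).modNat = j :=
    Prod.ext_iff.mp (finProdFinEquiv.symm_apply_apply (i, j))
  simpa only [flatten, hd.1, hd.2] using this

/-- Only few strings are the values on `I` of a circuit of size `m`, so that a distribution of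
min-entropy `m + k` hardly ever hits them. -/
theorem sum_valuesOn_le {a b t m k : ℕ} (I : Fin t → Bits a) (p : PMF (Fin t → Bits b))
    (hp : ∀ y, p y ≤ (2 ^ (m + k) : ENNReal)⁻¹) (B : Finset (Fin t → Bits b))
    (hB : ∀ y ∈ B, ∃ C : Bits m, valuesOn b I C = flatten y) :
    ∑ y ∈ B, (p y).toReal ≤ (1 / 2) ^ k := by
  have hcard : B.card ≤ 2 ^ m := by
    choose! C hC using hB
    calc B.card ≤ (Finset.univ : Finset (Bits m)).card := by
          refine Finset.card_le_card_of_injOn C (fun _ _ => Finset.mem_univ _) ?_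
          intro y hy y' hy' h
          exact flatten_injective ((hC y hy).symm.trans ((congrArg _ h).trans (hC y' hy')))
      _ = 2 ^ m := by simp
  have hle : ∀ y, (p y).toReal ≤ (1 / 2) ^ (m + k) := fun y => by
    have := ENNReal.toReal_mono (by simp) (hp y)
    simpa using this
  calc ∑ y ∈ B, (p y).toReal ≤ B.card • (1 / 2 : ℝ) ^ (m + k) :=
        Finset.sum_le_card_nsmul _ _ _ fun y _ => hle y
    _ ≤ (2 ^ m : ℝ) * (1 / 2) ^ (m + k) := by
        rw [nsmul_eq_mul]
        gcongr
        exact_mod_cast hcard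
    _ = (1 / 2) ^ k := by
        rw [pow_add, ← mul_assoc, ← mul_pow]
        norm_num

/-! ### Obfuscating the keyed circuits -/

namespace IsIndistinguishabilityObfuscator

variable {a b : ℕ → ℕ} {cls : ℕ → Set Circuit} {L : ℕ → ℕ → ℕ} {iO : ∀ k n, OCircuit (L k n)}

/-- `correct` for a string of length `d`, with the size of the output written as `L k d`. -/
theorem correct_ofFn (h : IsIndistinguishabilityObfuscator a b cls L iO) {k d : ℕ} {c : Bits d}
    (hc : List.ofFn c ∈ cls k) :
    ∀ z ∈ ((iO k d).runPlain (List.ofFn c)).support,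
      Circuit.eval (a k) (b k) (List.ofFn z) = Circuit.eval (a k) (b k) (List.ofFn c) := by
  have aux : ∀ (C : Circuit) (n : ℕ), C.length = n → C ∈ cls k →
      ∀ z ∈ ((iO k n).runPlain C).support,
        Circuit.eval (a k) (b k) (List.ofFn z) = Circuit.eval (a k) (b k) C := by
    rintro C _ rfl hC
    exact h.correct k C hC
  exact aux _ d (by simp) hc

/-- `indist` for strings of the same length and a distinguisher for a single size of its input. -/
theorem indist_ofFn (h : IsIndistinguishabilityObfuscator a b cls L iO) {D : ℕ → OCircuit 1}
    (hD : PPT D) : ∃ ε : ℕ → ℝ, Negligible ε ∧ ∀ (k d : ℕ) (c c' : Bits d),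
      List.ofFn c ∈ cls k → List.ofFn c' ∈ cls k →
      Circuit.eval (a k) (b k) (List.ofFn c) = Circuit.eval (a k) (b k) (List.ofFn c') →
      |prOne (((iO k d).runPlain (List.ofFn c)).bind fun z => (D k).runPlainBit (List.ofFn z)) -
        prOne (((iO k d).runPlain (List.ofFn c')).bind fun z =>
          (D k).runPlainBit (List.ofFn z))| ≤ ε k := by
  obtain ⟨q, hq⟩ := hD
  obtain ⟨ε, hε, H⟩ := h.indist (fun k _ => D k)
    ⟨q, fun k n => (hq k).trans (q.eval_nat_mono (Nat.le_add_right k n))⟩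
  have aux : ∀ (k : ℕ) (C : Circuit) (n : ℕ), C.length = n →
      ((iO k C.length).runPlain C).bind (fun z => (D k).runPlainBit (List.ofFn z)) =
        ((iO k n).runPlain C).bind fun z => (D k).runPlainBit (List.ofFn z) := by
    rintro k C _ rfl
    rfl
  refine ⟨ε, hε, fun k d c c' hc hc' hcc' => ?_⟩
  have := H k _ hc _ hc' (by simp) hcc'
  rwa [aux k _ d (by simp), aux k _ d (by simp)] at this

end IsIndistinguishabilityObfuscator

namespace KeyedCircuits

variable {a b m t : ℕ → ℕ} {I : ∀ k, Fin (t k) → Bits (a k)}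
  {G : PuncturablePRF (fun k => t k * b k) (fun _ => 1)} (𝒦 : KeyedCircuits a b m t I G)

theorem ofFn_K_mem_cls (k : ℕ) (s : Bits k) :
    List.ofFn ((𝒦.K k s).padTo (𝒦.d k)) ∈ 𝒦.cls k := Or.inl ⟨s, rfl⟩

theorem ofFn_Kstar_mem_cls (k : ℕ) {s : Bits k} {x : Bits (t k * b k)} {σ : Bits (G.pkLen k)}
    (h : σ ∈ (G.punc k s x).support) :
    List.ofFn ((𝒦.Kstar k σ x).padTo (𝒦.d k)) ∈ 𝒦.cls k := Or.inr ⟨s, x, σ, h, rfl⟩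

theorem eval_padTo_K (k : ℕ) (s : Bits k) (C : Bits (m k)) :
    Circuit.eval (m k) 1 (List.ofFn ((𝒦.K k s).padTo (𝒦.d k))) C =
      G.eval k s (valuesOn (b k) (I k) C) := by
  rw [Circuit.eval_padTo _ _ (𝒦.K_size k s), 𝒦.K_spec]

/-- If no circuit of size `m` takes the values `x` on `I`, then puncturing at `x` does not change
the function to be obfuscated. -/
theorem eval_padTo_K_eq_Kstar (k : ℕ) {s : Bits k} {x : Bits (t k * b k)} {σ : Bits (G.pkLen k)}
    (hs : s ∈ (G.gen k).support) (hσ : σ ∈ (G.punc k s x).support)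
    (hx : ∀ C : Bits (m k), valuesOn (b k) (I k) C ≠ x) :
    Circuit.eval (m k) 1 (List.ofFn ((𝒦.K k s).padTo (𝒦.d k))) =
      Circuit.eval (m k) 1 (List.ofFn ((𝒦.Kstar k σ x).padTo (𝒦.d k))) := by
  funext C
  rw [𝒦.eval_padTo_K, Circuit.eval_padTo _ _ (𝒦.Kstar_size k σ x), 𝒦.Kstar_spec, if_neg (hx C)]
  exact (G.functionality k x s hs σ hσ _ (hx C)).symm

end KeyedCircuits

/-! ### The attack, and the simulator's task -/

namespace CircuitFamily

variable {F : CircuitFamily}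

/-- The attacker reads the value of the keyed circuit `aux` at `f_s` off any obfuscation. -/
theorem prOne_realExp_eq_one {O : ℕ → Circuit → PMF Circuit} (hO : F.ObfCorrect O) {M t : ℕ → ℕ}
    (hM : ∀ k s, ∀ C ∈ (O k (F.circ k s)).support, C.length ≤ M k)
    {A : ℕ → ℕ → ℕ → OCircuit 1}
    (hA : ∀ (k : ℕ) (C aux : Circuit), (A k C.length aux.length).runPlainBit (C ++ aux) =
      PMF.pure (Circuit.eval (M k) 1 aux (Circuit.padTo (M k) C) 0))
    {I : ∀ k, Fin (t k) → Bits (F.inLen k)} {k : ℕ} {g : Bits (t k * F.outLen k) → Bits 1}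
    {aux : Circuit}
    (haux : ∀ C : Bits (M k), Circuit.eval (M k) 1 aux C = g (valuesOn (F.outLen k) (I k) C)) :
    prOne (F.realExp O A k (fun s _ => g (flatten fun i => F.fn k s (I k i)) 0) aux) = 1 := by
  have h : F.realExp O A k (fun s _ => g (flatten fun i => F.fn k s (I k i)) 0) aux =
      PMF.pure true := by
    rw [realExp, ← PMF.bind_const (PMF.uniformOfFintype (Bits k)) (PMF.pure true)]
    congr 1
    funext s
    rw [← PMF.bind_const (O k (F.circ k s)) (PMF.pure true)]
    refine PMF.bind_congr fun C hC => ?_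
    have hv : valuesOn (F.outLen k) (I k) (Circuit.padTo (M k) C) =
        flatten fun i => F.fn k s (I k i) := by
      rw [valuesOn, Circuit.eval_padTo _ _ (hM k s C hC), hO k s C hC]
    rw [hA, haux, hv, PMF.pure_map, beq_self_eq_true]
  rw [h, prOne_pure_true]

end CircuitFamily

/-! ### The simulator cannot guess the values of the punctured function -/

section Impossibility

open Filter

variable {F : CircuitFamily} {m t : ℕ → ℕ} {I : ∀ k, Fin (t k) → Bits (F.inLen k)}
  {G : PuncturablePRF (fun k => t k * F.outLen k) (fun _ => 1)}
  (𝒦 : KeyedCircuits F.inLen F.outLen m t I G) {L : ℕ → ℕ → ℕ} (iO : ∀ k n, OCircuit (L k n))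

/-- The obfuscation of the padded circuit `K_s`. -/
def KeyedCircuits.obfK (k : ℕ) (s : Bits k) : PMF (Bits (L k (𝒦.d k))) :=
  (iO k (𝒦.d k)).runPlain (List.ofFn ((𝒦.K k s).padTo (𝒦.d k)))

/-- The obfuscation of the padded circuit `K*_{σ,x}`. -/
def KeyedCircuits.obfKstar (k : ℕ) (σ : Bits (G.pkLen k)) (x : Bits (t k * F.outLen k)) :
    PMF (Bits (L k (𝒦.d k))) :=
  (iO k (𝒦.d k)).runPlain (List.ofFn ((𝒦.Kstar k σ x).padTo (𝒦.d k)))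

/-- The experiment in which `B`, on oracle `o` and an obfuscation of `K_s` for a random key `s`,
tries to compute the value of `G_s` at `o(I)`. -/
def KeyedCircuits.guess (B : ℕ → OCircuit 1) (k : ℕ)
    (o : Bits (F.inLen k) → Bits (F.outLen k)) : PMF Bool :=
  (G.gen k).bind fun s => (𝒦.obfK iO k s).bind fun z =>
    ((B k).runBit o (List.ofFn z)).map fun β => β == G.eval k s (flatten fun i => o (I k i)) 0

variable {iO}

theorem polyIn_obfuscator_size (hiO : PPT₁ iO) : PolyIn id fun k => (iO k (𝒦.d k)).size := by
  obtain ⟨q, hq⟩ := hiO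
  have h : PolyIn (fun k => k + 𝒦.d k) fun k => (iO k (𝒦.d k)).size :=
    ⟨q, fun k => hq k (𝒦.d k)⟩
  exact h.comp (PolyIn.self.add 𝒦.d_poly)

/-- The success of `B` can be tested with oracle access alone. -/
theorem exists_guess_distinguisher (hiO : PPT₁ iO) (ht : PolyBounded t)
    {B : ℕ → OCircuit 1} (hB : PPT B) : ∃ D : ℕ → OCircuit 1, PPT D ∧
      ∀ k (o : Bits (F.inLen k) → Bits (F.outLen k)), (D k).runBit o [] = 𝒦.guess iO B k o := by
  obtain ⟨Agen, hAgen, hgen⟩ := G.gen_eff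
  obtain ⟨AK, hAK, hK⟩ := 𝒦.K_eff
  obtain ⟨AG, hAG, hG⟩ := G.eval_eff
  choose D hD hrun using fun k => exists_oracleTest (hgen k) (hK k) (hG k) (iO k (𝒦.d k)) (B k) (I k)
  refine ⟨D, PolyIn.mono ?_ hD, hrun⟩
  have c := fun n => PolyIn.const (sz := (id : ℕ → ℕ)) n
  have ha : PolyIn id F.inLen := F.inLen_poly
  exact (((((((c 2).mul hAgen).add hAK).add
    ((c 2).mul (polyIn_obfuscator_size 𝒦 hiO))).add
      (PolyIn.mul hB ((c 3).add ha))).add (PolyIn.mul ht ((c 1).add ha))).add hAG).add (c 18)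

/-- Obfuscation hides the value of `G` at a point that is not described by any circuit of size `m`.
The key may be punctured there without changing the obfuscated function, and the value at the
punctured point is pseudo-random. -/
theorem guess_le (hiO : IsIndistinguishabilityObfuscator m (fun _ => 1) 𝒦.cls L iO)
    (ht : PolyBounded t) (hI : ∀ k, Function.Injective (I k)) {B : ℕ → OCircuit 1} (hB : PPT B)
    (s : ∀ k, Bits k) (y : ∀ k, Fin (t k) → Bits (F.outLen k)) :
    ∃ η : ℕ → ℝ, Tendsto η atTop (nhds 0) ∧ ∀ k,
      (∀ C : Bits (m k), valuesOn (F.outLen k) (I k) C ≠ flatten (y k)) →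
        prOne (𝒦.guess iO B k (Function.extend (I k) (y k) (F.fn k (s k)))) ≤ 1 / 2 + η k := by
  set o := fun k => Function.extend (I k) (y k) (F.fn k (s k)) with ho
  have hoI : ∀ k, (fun i => o k (I k i)) = y k := fun k => funext fun i => (hI k).extend_apply _ _ i
  -- the cost of evaluating the hardwired oracle
  set q : ℕ → ℕ := fun k => universalCost (F.inLen k) (F.outLen k) (F.circ k (s k)).length +
    (F.inLen k * 2 + (t k * (1 + F.inLen k) + F.outLen k * (2 * t k + 4)))
  have c := fun n => PolyIn.const (sz := (id : ℕ → ℕ)) n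
  have ha : PolyIn id F.inLen := F.inLen_poly
  have hb : PolyIn id F.outLen := F.outLen_poly
  have ht' : PolyIn id t := ht
  have hcirc : PolyIn id fun k => (F.circ k (s k)).length :=
    F.circ_poly.imp fun _ h k => h k (s k)
  have hq : PolyIn id q := (ha.universalCost hb hcirc).add ((ha.mul (c 2)).add
    ((ht'.mul ((c 1).add ha)).add (hb.mul (((c 2).mul ht').add (c 4)))))
  have himpl : ∀ k {Γ : Type} {K : Set (Γ → Bool)}, constBits Γ ⊆ K →
      Implements (fun _ => (id : Bits 0 → Bits 0)) (q k) K fun _ => o k :=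
    fun k _ _ hK => implements_extend hK (F.circ k (s k)) (I k) (hI k) (y k)
  have hBq : PolyIn id fun k => (B k).size * (2 + q k) := PolyIn.mul hB ((c 2).add hq)
  choose D hD hDrun using fun (β : Bool) k =>
    exists_hardwiredTest (n := L k (𝒦.d k)) (himpl k) (B k) β
  have hDP : ∀ β, PPT (D β) := fun β => PolyIn.mono (hBq.add (c 18)) (hD β)
  choose ε hε hεle using fun β => hiO.indist_ofFn (hDP β)
  obtain ⟨AK, hAK, hK⟩ := 𝒦.Kstar_eff
  choose D' hD' hDrun' using fun k =>
    exists_puncturedTest (hK k) (himpl k) (iO k (𝒦.d k)) (B k)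
  have hDP' : PPT D' := PolyIn.mono (((PolyIn.add hAK ((c 2).mul
    (polyIn_obfuscator_size 𝒦 hiO.efficient))).add hBq).add (c 18)) hD'
  obtain ⟨ε', hε', hεle'⟩ := G.indist D' hDP'
  refine ⟨fun k => max (ε false k) (ε true k) + ε' k, ?_, fun k hk => ?_⟩
  · simpa using ((hε false).tendsto.max (hε true).tendsto).add hε'.tendsto
  have h1 : |prOne (𝒦.guess iO B k (o k)) - prOne ((G.gen k).bind fun s' =>
      (G.punc k s' (flatten (y k))).bind fun σ => (𝒦.obfKstar iO k σ (flatten (y k))).bind fun z =>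
        ((B k).runBit (o k) (List.ofFn z)).map fun β =>
          β == G.eval k s' (flatten (y k)) 0)| ≤ max (ε false k) (ε true k) := by
    rw [KeyedCircuits.guess, hoI]
    refine abs_prOne_bind_sub_le fun s' hs' => ?_
    rw [← PMF.bind_const (G.punc k s' (flatten (y k))) ((𝒦.obfK iO k s').bind _)]
    refine abs_prOne_bind_sub_le fun σ hσ => ?_
    have h := hεle (G.eval k s' (flatten (y k)) 0) k (𝒦.d k) _ _ (𝒦.ofFn_K_mem_cls k s')
      (𝒦.ofFn_Kstar_mem_cls k hσ) (𝒦.eval_padTo_K_eq_Kstar k hs' hσ hk)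
    simp only [hDrun] at h
    refine h.trans ?_
    cases G.eval k s' (flatten (y k)) 0
    · exact le_max_left _ _
    · exact le_max_right _ _
  have h2 := hεle' k (flatten (y k))
  simp only [hDrun'] at h2
  have h3 : prOne ((G.gen k).bind fun s' => (G.punc k s' (flatten (y k))).bind fun σ =>
      (PMF.uniformOfFintype (Bits 1)).bind fun u => (𝒦.obfKstar iO k σ (flatten (y k))).bind fun z =>
        ((B k).runBit (o k) (List.ofFn z)).map fun β => β == u 0) ≤ 1 / 2 := by
    refine prOne_bind_le (by norm_num) fun s' => prOne_bind_le (by norm_num) fun σ => ?_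
    rw [PMF.bind_comm]
    exact prOne_bind_le (by norm_num) fun z => (prOne_guess _).le
  have h1' := (abs_le.mp h1).2
  have h2' := (abs_le.mp h2).2
  rw [← ho] at *
  simp only [KeyedCircuits.obfKstar] at h1' h3
  linarith

end Impossibility

end

theorem theorem1 (F : CircuitFamily) (hF : F.SuperPolyPseudoEntropy)
    (hiO : ∀ m : Polynomial ℕ, ∃ (t : ℕ → ℕ) (I : ∀ k, Fin (t k) → Bits (F.inLen k)),
      F.PseudoEntropicOn (fun k => m.eval k + k) t I ∧
      ∃ (G : PuncturablePRF (fun k => t k * F.outLen k) (fun _ => 1))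
        (𝒦 : KeyedCircuits F.inLen F.outLen (fun k => m.eval k) t I G)
        (L : ℕ → ℕ → ℕ) (iO : ∀ k n, OCircuit (L k n)),
        IsIndistinguishabilityObfuscator (fun k => m.eval k) (fun _ => 1) 𝒦.cls L iO) :
    ¬ ∃ O : ℕ → Circuit → PMF Circuit, F.IsAverageCaseObfuscator O := by
  rintro ⟨O, hcorrect, ⟨p, hp⟩, hsecure⟩
  obtain ⟨q, hq⟩ := F.circ_poly
  -- `m` bounds the size of the obfuscations of `f_s`
  set m : Polynomial ℕ := p.comp q with hm
  have hOm : ∀ k s, ∀ C ∈ (O k (F.circ k s)).support, C.length ≤ m.eval k := fun k s C hC => by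
    rw [hm, Polynomial.eval_comp]
    exact (hp k s C hC).trans (p.eval_nat_mono (hq k s))
  obtain ⟨t, I, ⟨ht, hI, Y, hYentropy, hYindist⟩, G, 𝒦, L, iO, hiO⟩ := hiO m
  obtain ⟨A, hA, hArun⟩ := exists_attacker m
  obtain ⟨S, ⟨qS, hS⟩, hSsim⟩ := hsecure A hA
  have hL : PolyIn id fun k => L k (𝒦.d k) := by
    obtain ⟨r, hr⟩ := hiO.slowdown
    refine PolyIn.comp (g := 𝒦.d) ⟨r, fun k => ?_⟩ 𝒦.d_poly
    simpa using hr k _ (𝒦.ofFn_K_mem_cls k fun _ => false)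
  obtain ⟨rL, hrL⟩ := hL
  obtain ⟨ε, hε, hεle⟩ := hSsim rL
  set B : ℕ → OCircuit 1 := fun k => S k (L k (𝒦.d k))
  have hB : PPT B := by
    have h : PolyIn (fun k => k + L k (𝒦.d k)) fun k => (B k).size := ⟨qS, fun k => hS k _⟩
    exact h.comp (PolyIn.self.add ⟨rL, hrL⟩)
  -- on oracle `f_s`, the simulator computes the value of `G` like the attacker
  have hreal : ∀ k, 1 - ε k ≤ prOne ((PMF.uniformOfFintype (Bits k)).bind fun s =>
      𝒦.guess iO B k (F.fn k s)) := fun k => by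
    simp only [KeyedCircuits.guess]
    rw [PMF.bind_comm]
    refine le_prOne_bind fun s' _ => ?_
    rw [PMF.bind_comm]
    refine le_prOne_bind fun z hz => ?_
    have h := hεle k (fun s _ => G.eval k s' (flatten fun i => F.fn k s (I k i)) 0) (List.ofFn z)
      (by simpa using hrL k)
    rw [CircuitFamily.prOne_realExp_eq_one hcorrect hOm hArun fun C => by
      rw [hiO.correct_ofFn (𝒦.ofFn_K_mem_cls k s') z hz, 𝒦.eval_padTo_K]] at h
    simp only [CircuitFamily.idealExp, List.length_ofFn] at h
    linarith [(abs_le.mp h).2]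
  obtain ⟨D, hD, hDrun⟩ := exists_guess_distinguisher 𝒦 hiO.efficient ht hB
  have hδ := hYindist D hD
  simp only [hDrun] at hδ
  -- fix values `y` not described by circuits of size `m`, on which the simulator still succeeds
  let good : ∀ k, Bits k → (Fin (t k) → Bits (F.outLen k)) → Prop := fun k s y =>
    (∀ C : Bits (m.eval k), valuesOn (F.outLen k) (I k) C ≠ flatten y) ∧
      3 / 4 < prOne (𝒦.guess iO B k (Function.extend (I k) y (F.fn k s)))
  have hchoice : ∀ k, ∃ sy : Bits k × (Fin (t k) → Bits (F.outLen k)),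
      (∃ s y, good k s y) → good k sy.1 sy.2 := fun k => by
    by_cases h : ∃ s y, good k s y
    · obtain ⟨s, y, h⟩ := h
      exact ⟨(s, y), fun _ => h⟩
    · exact ⟨(fun _ => false, fun _ _ => false), fun h' => absurd h' h⟩
  choose sy hsy using hchoice
  obtain ⟨η, hη, hηle⟩ := guess_le 𝒦 hiO ht hI hB (fun k => (sy k).1) fun k => (sy k).2
  have hpow : Filter.Tendsto (fun k : ℕ => (1 / 2 : ℝ) ^ k) Filter.atTop (nhds 0) :=
    tendsto_pow_atTop_nhds_zero_of_lt_one (by norm_num) (by norm_num)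
  obtain ⟨k, hYk, hηk, hεk, hδk, hpowk⟩ := (hYentropy.and
    ((hη.eventually_lt_const (by norm_num : (0 : ℝ) < 1 / 4)).and
    ((hε.tendsto.eventually_lt_const (by norm_num : (0 : ℝ) < 1 / 16)).and
    ((hδ.tendsto.eventually_lt_const (by norm_num : (0 : ℝ) < 1 / 16)).and
    (hpow.eventually_lt_const (by norm_num : (0 : ℝ) < 1 / 16)))))).exists
  by_cases hgood : ∃ s y, good k s y
  · obtain ⟨hy, hlt⟩ := hsy k hgood
    linarith [hηle k hy]
  · have hY : prOne ((PMF.uniformOfFintype (Bits k)).bind fun s => (Y k s).bind fun y =>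
        𝒦.guess iO B k (Function.extend (I k) y (F.fn k s))) ≤ (1 / 2) ^ k + 3 / 4 := by
      classical
      refine prOne_bind_le (by positivity) fun s => ?_
      refine prOne_bind_le_of_rare (by norm_num)
        (Finset.univ.filter fun y => ∃ C : Bits (m.eval k),
          valuesOn (F.outLen k) (I k) C = flatten y)
        (sum_valuesOn_le (I k) (Y k s) (hYk s) _ (by simp)) fun y hy => ?_
      by_contra hlt
      exact hgood ⟨s, y, fun C hC => hy (by simpa using ⟨C, hC⟩), not_le.mp hlt⟩
    linarith [hreal k, (abs_le.mp hδk.le).2]
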